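/- **Setting.** For every sample size $n$ let $p=p_n\in\mathbb N$, $\beta=\beta^{(n)}\in\mathbb R^{p}$, $\sigma^2=\sigma_n^2$, and let $(X_1,Y_1),\dots,(X_n,Y_n)$ (the $n$-th row of a triangular array) be i.i.d. with $X_i\in\mathbb R^p$, $Y_i=\beta^TX_i+\epsilon_i$, $E(\epsilon_i\mid X_i)=0$, $E(\epsilon_i^2\mid X_i)=\sigma^2<\infty$. Put $\tau^2=\|\beta\|^2$, $W_{ij}=X_{ij}Y_i$, and $$\hat\beta_j^2=\frac1{n(n-1)}\sum_{i_1\ne i_2}W_{i_1j}W_{i_2j},\qquad \hat\tau^2=\sum_{j=1}^p\hat\beta_j^2,\qquad \hat\sigma_Y^2=\frac1{n-1}\sum_{i=1}^n(Y_i-\bar Y)^2,$$ $$\hat\psi_{jj'}=\frac1{n(n-1)(n-2)}\sum_{i_1,i_2,i_3\text{ pairwise distinct}}W_{i_1j}W_{i_2j'}\left[X_{i_3j}X_{i_3j'}-E(X_{i_3j}X_{i_3j'})\right].$$ For $S\subseteq\{1,\dots,p\}$ put $T_S=\hat\tau^2-2\sum_{j,j'\in S}\hat\psi_{jj'}$ and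 $\hat\tau_S^2=\sum_{j\in S}\hat\beta_j^2$; write $\hat\sigma_Y^4=(\hat\sigma_Y^2)^2$, $\hat\tau^4=(\hat\tau^2)^2$, $\hat\tau_S^4=(\hat\tau_S^2)^2$. A selection algorithm $\gamma$ assigns to every dataset $(X_{n\times p},Y_{n\times1})$, measurably, a set $B_\gamma\subseteq\{1,\dots,p\}$; put $T_\gamma=T_{B_\gamma}$ (with the data-dependent set $B_\gamma$). Let $$\widehat{\mathrm{Var}}(\hat\tau^2)=\frac4n\left[\frac{n-2}{n-1}\left(\hat\sigma_Y^2\hat\tau^2+\hat\tau^4\right)+\frac1{2(n-1)}\left(p\,\hat\sigma_Y^4+4\hat\sigma_Y^2\hat\tau^2+3\hat\tau^4\right)\right],\qquad \widehat{\mathrm{Var}}(T_\gamma)=\widehat{\mathrm{Var}}(\hat\tau^2)-\frac8n\hat\tau_{B_\gamma}^4 .$$ **Proposition.** Assume, as $n\to\infty$: 1. $X_i\sim N(\mathbf 0,\mathbf I_p)$, $\tau^2+\sigma^2=O(1)$ and $p/n=O(1)$; 2. the squared errors $(\epsilon_i^{(n)})^2$, $1\le i\le n$, $n\ge1$, are uniformly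 integrable (automatic, for instance, when the law of the errors does not depend on $n$); 3. there are constants $b>0$ and $p_0$, not depending on $n$, such that $B=\{j:\beta_j^2>b\}$ satisfies $|B|=p_0$ for all large $n$; 4. $\lim_{n\to\infty}n\,[P(B_\gamma\ne B)]^{1/2}=0$; 5. $E(T_\gamma^4)$ and $E(T_B^4)$ are finite and bounded, for all large $n$. Then $$n\left[\widehat{\mathrm{Var}}(T_\gamma)-\mathrm{Var}(T_\gamma)\right]\xrightarrow{\;p\;}0 .$$ -/

import Mathlib

open MeasureTheory ProbabilityTheory Filter Asymptotics Topology

noncomputable section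

namespace SignalEst

variable {n p : ℕ}

/-! ### Statistics of a dataset

A dataset consists of a design matrix `X` (with rows `X i`, `i : Fin n`) and a response vector
`Y`. -/

/-- `W_{ij} = X_{ij} Y_i`. -/
def W (X : Fin n → Fin p → ℝ) (Y : Fin n → ℝ) (i : Fin n) (j : Fin p) : ℝ := X i j * Y i

/-- The unbiased estimator of `β_j²`. -/
def betaSqHat (X : Fin n → Fin p → ℝ) (Y : Fin n → ℝ) (j : Fin p) : ℝ :=
  1 / ((n : ℝ) * ((n : ℝ) - 1)) *
    ∑ i₁ : Fin n, ∑ i₂ : Fin n, if i₁ ≠ i₂ then W X Y i₁ j * W X Y i₂ j else 0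

/-- The partial sum of the `β̂_j²` over an index set `S`. -/
def tauSqHatOn (X : Fin n → Fin p → ℝ) (Y : Fin n → ℝ) (S : Finset (Fin p)) : ℝ :=
  ∑ j ∈ S, betaSqHat X Y j

/-- The naive estimator of `τ² = ‖β‖²`. -/
def tauSqHat (X : Fin n → Fin p → ℝ) (Y : Fin n → ℝ) : ℝ :=
  ∑ j : Fin p, betaSqHat X Y j

/-- The sample variance of the responses. -/
def sigmaYSqHat (Y : Fin n → ℝ) : ℝ :=
  1 / ((n : ℝ) - 1) * ∑ i : Fin n, (Y i - 1 / (n : ℝ) * ∑ k : Fin n, Y k) ^ 2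

/-- The zero-estimator `ψ̂_{jj'}`. The measure `P` is the (known) distribution of a row of the
design matrix, so that `∫ x, x j * x j' ∂P` is `E(X_{ij} X_{ij'})`. The sum is over triples of
pairwise distinct observations. -/
def psiHat (P : Measure (Fin p → ℝ)) (X : Fin n → Fin p → ℝ) (Y : Fin n → ℝ)
    (j j' : Fin p) : ℝ :=
  1 / ((n : ℝ) * ((n : ℝ) - 1) * ((n : ℝ) - 2)) *
    ∑ i₁ : Fin n, ∑ i₂ : Fin n, ∑ i₃ : Fin n,
      if i₁ ≠ i₂ ∧ i₁ ≠ i₃ ∧ i₂ ≠ i₃ then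
        W X Y i₁ j * W X Y i₂ j' * (X i₃ j * X i₃ j' - ∫ x, x j * x j' ∂P)
      else 0

/-- `T_S = τ̂² - 2 ∑_{j, j' ∈ S} ψ̂_{jj'}`. -/
def TOn (P : Measure (Fin p → ℝ)) (X : Fin n → Fin p → ℝ) (Y : Fin n → ℝ)
    (S : Finset (Fin p)) : ℝ :=
  tauSqHat X Y - 2 * ∑ j ∈ S, ∑ j' ∈ S, psiHat P X Y j j'

/-- The plug-in estimator of `Var(τ̂²)`. -/
def varHatTauSqHat (X : Fin n → Fin p → ℝ) (Y : Fin n → ℝ) : ℝ :=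
  4 / (n : ℝ) *
    (((n : ℝ) - 2) / ((n : ℝ) - 1) * (sigmaYSqHat Y * tauSqHat X Y + tauSqHat X Y ^ 2) +
      1 / (2 * ((n : ℝ) - 1)) *
        ((p : ℝ) * sigmaYSqHat Y ^ 2 + 4 * sigmaYSqHat Y * tauSqHat X Y +
          3 * tauSqHat X Y ^ 2))

/-- The estimator `Var̂(τ̂²) - (8/n) τ̂_S⁴` of `Var(T_S)`. -/
def varHatTOn (X : Fin n → Fin p → ℝ) (Y : Fin n → ℝ) (S : Finset (Fin p)) : ℝ :=
  varHatTauSqHat X Y - 8 / (n : ℝ) * tauSqHatOn X Y S ^ 2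

/-- A covariate selection algorithm: for every dataset of every size it chooses, measurably in the
data, a subset of the covariates. -/
structure SelectionAlgorithm where
  /-- The set of selected covariates. -/
  select : ∀ {n p : ℕ}, (Fin n → Fin p → ℝ) → (Fin n → ℝ) → Finset (Fin p)
  measurableSet_select : ∀ (n p : ℕ) (S : Finset (Fin p)),
    MeasurableSet {d : (Fin n → Fin p → ℝ) × (Fin n → ℝ) | select d.1 d.2 = S}

/-! ### The population model -/

/-- `τ² = ‖β‖²` (for covariates with identity covariance matrix). -/
def tauSq (β : Fin p → ℝ) : ℝ := ∑ j : Fin p, β j ^ 2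

/-- The set `{j : β_j² > b}` of large coefficients. -/
def largeCoeffs (β : Fin p → ℝ) (b : ℝ) : Finset (Fin p) := {j : Fin p | b < β j ^ 2}

/-- The standard normal distribution `N(0, I)` on `ℝ^p`. -/
def stdNormal (p : ℕ) : Measure (Fin p → ℝ) := Measure.pi fun _ => gaussianReal 0 1

variable {Ω : Type*} [MeasurableSpace Ω]

/-- The error `ε_i = Y_i - βᵀ X_i`. -/
def noise (β : Fin p → ℝ) (X : Fin n → Ω → Fin p → ℝ) (Y : Fin n → Ω → ℝ) (i : Fin n)
    (ω : Ω) : ℝ :=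
  Y i ω - ∑ j : Fin p, β j * X i ω j

/-- The linear model: the observations `(X_i, Y_i)` are i.i.d., and `Y_i = βᵀ X_i + ε_i` where
`E(ε_i | X_i) = 0` and `E(ε_i² | X_i) = σ²`. -/
structure IsLinearModel (μ : Measure Ω) (β : Fin p → ℝ) (sigmaSq : ℝ)
    (X : Fin n → Ω → Fin p → ℝ) (Y : Fin n → Ω → ℝ) : Prop where
  measurable_X : ∀ i, Measurable (X i)
  measurable_Y : ∀ i, Measurable (Y i)
  indep : iIndepFun (fun i ω => (X i ω, Y i ω)) μ
  identDistrib : ∀ i k, IdentDistrib (fun ω => (X i ω, Y i ω)) (fun ω => (X k ω, Y k ω)) μ μ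
  memLp_noise : ∀ i, MemLp (noise β X Y i) 2 μ
  condExp_noise : ∀ i,
    μ[noise β X Y i | MeasurableSpace.comap (X i) inferInstance] =ᵐ[μ] fun _ => 0
  condExp_noise_sq : ∀ i,
    μ[fun ω => noise β X Y i ω ^ 2 | MeasurableSpace.comap (X i) inferInstance]
      =ᵐ[μ] fun _ => sigmaSq

end SignalEst

end

namespace SignalEst

set_option linter.unusedSectionVars false

open scoped ENNReal NNReal Matrix

/-! ### Moments of centred Gaussian variables -/

section MGF

variable {Ω : Type*} [MeasurableSpace Ω] {μ : Measure Ω} {Z : Ω → ℝ} {v : ℝ}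

/-! Write `σ_Y² = τ² + σ²` and `τ_S² = ∑_{j ∈ S} β_j²`. The proof compares both the estimated and
the true variance with `leadingVar`, that is `4/n (τ² σ_Y² + τ⁴ - 2 τ_S⁴) + 2/(n(n-1)) (p σ_Y⁴ + 2
σ_Y² τ² + τ⁴)`, taken at `S = B`.

True variance, fixed set. Centring `W_{ij}` at `β_j` gives the Hoeffding decomposition `TOn_eq`:
`T_S` is `τ²` plus a linear term, plus a degenerate quadratic term, plus a remainder coming from the
zero-estimators. The first two random terms are uncorrelated, and the Gaussian fourth moments make
their total variance exactly `leadingVar` (`moments_leadingTerm`). The remainder is a sum of `|S|²`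
degenerate U-statistics, each with second moment `O(n⁻²)` (`integral_psiRem_sq_le`). Since `|B|`
stays fixed and `leadingVar` is `O(1/n)`, Cauchy–Schwarz leaves an error `O(n^{-1/2})` after
multiplication by `n` (`scaled_abs_variance_TOn_sub_le`).

True variance, selected set. `T_γ` and `T_B` differ only on the event of a wrong selection. Bounded
fourth moments and Cauchy–Schwarz bound the difference of their variances by a constant times the
square root of its probability (`abs_variance_sub_le_of_eqOn`), and the selection hypothesis says
that `n` times this root vanishes.

Estimated variance. With the true parameters inserted, the plug-in formula equals `leadingVar`
exactly, and `n` times it is locally Lipschitz in the inserted values, uniformly in `n` because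
`p/n` is bounded (`abs_scaled_varHat_sub_le`). It remains to see that the inserted estimators are
consistent: those of `τ²` and `τ_B²` by their second moments (`integral_abs_tauSqHatOn_sub_le`), the
sample variance of the responses by truncating the squared errors
(`integral_abs_sigmaYSqHat_sub_le`), which is where uniform integrability enters. -/

lemma integrableExpSet_eq_univ_of_mgf (h : ∀ t, mgf Z μ t = Real.exp (v * t ^ 2 / 2)) :
    integrableExpSet Z μ = Set.univ := by
  refine Set.eq_univ_of_forall fun t => ?_
  by_contra hn
  -- Where `exp (t Z)` is not integrable the moment generating function takes the default value 0,
  -- but the Gaussian formula is positive.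
  have h0 := mgf_undef (X := Z) (μ := μ) (t := t) hn
  rw [h t] at h0
  exact (Real.exp_pos _).ne' h0

lemma zero_mem_interior_of_mgf (h : ∀ t, mgf Z μ t = Real.exp (v * t ^ 2 / 2)) :
    (0 : ℝ) ∈ interior (integrableExpSet Z μ) := by
  simp [integrableExpSet_eq_univ_of_mgf h]

lemma hasDerivAt_mul_gaussian_mgf (q : ℝ → ℝ) (q' t : ℝ) (hq : HasDerivAt q q' t) :
    HasDerivAt (fun t => q t * Real.exp (v * t ^ 2 / 2))
      ((q' + q t * (v * t)) * Real.exp (v * t ^ 2 / 2)) t := by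
  have h1 : HasDerivAt (fun t : ℝ => v * t ^ 2 / 2) (v * t) t := by
    refine (((hasDerivAt_pow 2 t).const_mul v).div_const 2).congr_deriv ?_
    simp only [Nat.cast_ofNat, Nat.add_one_sub_one, pow_one]
    ring
  refine (hq.fun_mul h1.exp).congr_deriv ?_
  ring

/-- The moments are derivatives of the moment generating function at 0. Each derivative is a
polynomial times the same exponential, and `hasDerivAt_mul_gaussian_mgf` gives the recursion `q ↦ q'
+ v t q` for the polynomial. -/
lemma moments_of_mgf (h : ∀ t, mgf Z μ t = Real.exp (v * t ^ 2 / 2)) :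
    ∫ ω, Z ω ^ 2 ∂μ = v ∧ ∫ ω, Z ω ^ 4 ∂μ = 3 * v ^ 2 := by
  have h0 := zero_mem_interior_of_mgf h
  have e0 : iteratedDeriv 0 (mgf Z μ) = fun t => 1 * Real.exp (v * t ^ 2 / 2) := by
    ext t; simp [h]
  have e1 : iteratedDeriv 1 (mgf Z μ) = fun t => (v * t) * Real.exp (v * t ^ 2 / 2) := by
    ext t
    rw [iteratedDeriv_succ, e0,
      (hasDerivAt_mul_gaussian_mgf (fun _ => 1) 0 t (hasDerivAt_const _ _)).deriv]
    ring
  have e2 : iteratedDeriv 2 (mgf Z μ)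
      = fun t => (v + v ^ 2 * t ^ 2) * Real.exp (v * t ^ 2 / 2) := by
    ext t
    rw [iteratedDeriv_succ, e1, (hasDerivAt_mul_gaussian_mgf (fun t => v * t) v t
      (by simpa using (hasDerivAt_id t).const_mul v)).deriv]
    ring
  have e3 : iteratedDeriv 3 (mgf Z μ)
      = fun t => (3 * v ^ 2 * t + v ^ 3 * t ^ 3) * Real.exp (v * t ^ 2 / 2) := by
    ext t
    rw [iteratedDeriv_succ, e2,
      (hasDerivAt_mul_gaussian_mgf (fun t => v + v ^ 2 * t ^ 2) (v ^ 2 * (2 * t)) t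
        (by simpa using ((hasDerivAt_pow 2 t).const_mul (v ^ 2)).const_add v)).deriv]
    ring
  have e4 : iteratedDeriv 4 (mgf Z μ) 0 = 3 * v ^ 2 := by
    have hd : HasDerivAt (fun t : ℝ => 3 * v ^ 2 * t + v ^ 3 * t ^ 3) (3 * v ^ 2) 0 := by
      have := ((hasDerivAt_id (0 : ℝ)).const_mul (3 * v ^ 2)).fun_add
        ((hasDerivAt_pow 3 (0 : ℝ)).const_mul (v ^ 3))
      simpa using this
    rw [iteratedDeriv_succ, e3, (hasDerivAt_mul_gaussian_mgf _ _ 0 hd).deriv]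
    simp
  constructor
  · simpa using (iteratedDeriv_mgf_zero h0 2).symm.trans (congrFun e2 0)
  · have := (iteratedDeriv_mgf_zero h0 4).symm.trans e4
    simpa using this

end MGF

/-! ### Linear forms in a standard normal vector -/

section Normal

variable {p : ℕ}

instance : IsProbabilityMeasure (stdNormal p) := by unfold stdNormal; infer_instance

lemma mgf_dotProduct (a : Fin p → ℝ) (t : ℝ) :
    mgf (fun x => a ⬝ᵥ x) (stdNormal p) t = Real.exp ((a ⬝ᵥ a) * t ^ 2 / 2) := by
  have hind : iIndepFun (fun (j : Fin p) (x : Fin p → ℝ) => a j * x j) (stdNormal p) :=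
    iIndepFun_pi (X := fun j (y : ℝ) => a j * y) (fun j => by fun_prop)
  have hsum : (fun x : Fin p → ℝ => a ⬝ᵥ x)
      = ∑ j, (fun (x : Fin p → ℝ) => a j * x j) := by
    ext x; simp [dotProduct]
  rw [hsum, hind.mgf_sum (fun j => by fun_prop)]
  have h1 : ∀ j, mgf (fun x : Fin p → ℝ => a j * x j) (stdNormal p) t
      = Real.exp (a j * a j * t ^ 2 / 2) := by
    intro j
    have hm : (stdNormal p).map (fun x : Fin p → ℝ => x j) = gaussianReal 0 1 :=
      (measurePreserving_eval (fun _ : Fin p => gaussianReal 0 1) j).map_eq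
    have := mgf_gaussianReal hm (a j * t)
    rw [show mgf (fun x : Fin p → ℝ => a j * x j) (stdNormal p) t
      = mgf (fun x : Fin p → ℝ => x j) (stdNormal p) (a j * t) from mgf_const_mul _, this]
    congr 1
    simp
    ring
  rw [Finset.prod_congr rfl fun j _ => h1 j, ← Real.exp_sum]
  congr 1
  rw [dotProduct, Finset.sum_mul, Finset.sum_div]

lemma memLp_dotProduct (a : Fin p → ℝ) (q : ℝ≥0) :
    MemLp (fun x => a ⬝ᵥ x) q (stdNormal p) :=
  memLp_of_mem_interior_integrableExpSet (zero_mem_interior_of_mgf (mgf_dotProduct a)) q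

lemma integral_dotProduct_sq (a : Fin p → ℝ) :
    ∫ x, (a ⬝ᵥ x) ^ 2 ∂stdNormal p = a ⬝ᵥ a :=
  (moments_of_mgf (mgf_dotProduct a)).1

lemma integral_dotProduct_pow_four (a : Fin p → ℝ) :
    ∫ x, (a ⬝ᵥ x) ^ 4 ∂stdNormal p = 3 * (a ⬝ᵥ a) ^ 2 :=
  (moments_of_mgf (mgf_dotProduct a)).2

lemma memLp_dotProduct_mul (u v : Fin p → ℝ) :
    MemLp (fun x => (u ⬝ᵥ x) * (v ⬝ᵥ x)) 2 (stdNormal p) := by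
  have : ENNReal.HolderTriple ((4 : ℝ≥0) : ℝ≥0∞) ((4 : ℝ≥0) : ℝ≥0∞) 2 := by
    constructor
    rw [show (2 : ℝ≥0∞) = ((2 : ℝ≥0) : ℝ≥0∞) from rfl, ← ENNReal.coe_inv (by norm_num),
      ← ENNReal.coe_inv (by norm_num), ← ENNReal.coe_add]
    congr 1
    ext
    push_cast
    norm_num
  exact (memLp_dotProduct v 4).mul' (memLp_dotProduct u 4)

lemma integrable_dotProduct_mul (u v : Fin p → ℝ) :
    Integrable (fun x => (u ⬝ᵥ x) * (v ⬝ᵥ x)) (stdNormal p) :=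
  (memLp_dotProduct_mul u v).integrable (by norm_num)

lemma integrable_dotProduct_mul_four (u v w z : Fin p → ℝ) :
    Integrable (fun x => (u ⬝ᵥ x) * (v ⬝ᵥ x) * ((w ⬝ᵥ x) * (z ⬝ᵥ x))) (stdNormal p) :=
  (memLp_dotProduct_mul u v).integrable_mul (memLp_dotProduct_mul w z)

/-- Polarization: only powers of a single linear form are known so far, and mixed moments are
recovered from `u + v` and `u - v`. The next two lemmas work in the same way, the first of them via
`(a+b)⁴ + (a-b)⁴ = 2a⁴ + 12a²b² + 2b⁴`. -/
lemma integral_dotProduct_mul (u v : Fin p → ℝ) :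
    ∫ x, (u ⬝ᵥ x) * (v ⬝ᵥ x) ∂stdNormal p = u ⬝ᵥ v := by
  have e : ∀ x, (u ⬝ᵥ x) * (v ⬝ᵥ x)
      = 4⁻¹ * (((u + v) ⬝ᵥ x) ^ 2 - ((u - v) ⬝ᵥ x) ^ 2) := by
    intro x; rw [add_dotProduct, sub_dotProduct]; ring
  have i : ∀ a : Fin p → ℝ, Integrable (fun x => (a ⬝ᵥ x) ^ 2) (stdNormal p) := fun a => by
    simpa only [sq] using integrable_dotProduct_mul a a
  simp_rw [e]
  rw [integral_const_mul, integral_sub (i _) (i _), integral_dotProduct_sq,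
    integral_dotProduct_sq]
  simp only [add_dotProduct, sub_dotProduct, dotProduct_add, dotProduct_sub]
  rw [dotProduct_comm v u]
  ring

lemma integral_dotProduct_sq_mul_sq (u w : Fin p → ℝ) :
    ∫ x, (u ⬝ᵥ x) ^ 2 * (w ⬝ᵥ x) ^ 2 ∂stdNormal p
      = (u ⬝ᵥ u) * (w ⬝ᵥ w) + 2 * (u ⬝ᵥ w) ^ 2 := by
  have e : ∀ x, (u ⬝ᵥ x) ^ 2 * (w ⬝ᵥ x) ^ 2
      = 12⁻¹ * (((u + w) ⬝ᵥ x) ^ 4 + ((u - w) ⬝ᵥ x) ^ 4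
        - (2 * (u ⬝ᵥ x) ^ 4 + 2 * (w ⬝ᵥ x) ^ 4)) := by
    intro x; rw [add_dotProduct, sub_dotProduct]; ring
  have i : ∀ a : Fin p → ℝ, Integrable (fun x => (a ⬝ᵥ x) ^ 4) (stdNormal p) := fun a => by
    refine (integrable_dotProduct_mul_four a a a a).congr (.of_forall fun x => ?_)
    simp only
    ring
  simp_rw [e]
  rw [integral_const_mul, integral_sub ((i _).fun_add (i _)) (((i _).const_mul _).fun_add
    ((i _).const_mul _)), integral_add (i _) (i _), integral_add ((i _).const_mul _)
    ((i _).const_mul _), integral_const_mul, integral_const_mul]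
  simp only [integral_dotProduct_pow_four]
  simp only [add_dotProduct, sub_dotProduct, dotProduct_add, dotProduct_sub]
  rw [dotProduct_comm w u]
  ring

lemma integral_dotProduct_mul_mul_sq (u v w : Fin p → ℝ) :
    ∫ x, (u ⬝ᵥ x) * (v ⬝ᵥ x) * (w ⬝ᵥ x) ^ 2 ∂stdNormal p
      = (u ⬝ᵥ v) * (w ⬝ᵥ w) + 2 * (u ⬝ᵥ w) * (v ⬝ᵥ w) := by
  have e : ∀ x, (u ⬝ᵥ x) * (v ⬝ᵥ x) * (w ⬝ᵥ x) ^ 2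
      = 4⁻¹ * (((u + v) ⬝ᵥ x) ^ 2 * (w ⬝ᵥ x) ^ 2 - ((u - v) ⬝ᵥ x) ^ 2 * (w ⬝ᵥ x) ^ 2) := by
    intro x; rw [add_dotProduct, sub_dotProduct]; ring
  have i : ∀ a : Fin p → ℝ,
      Integrable (fun x => (a ⬝ᵥ x) ^ 2 * (w ⬝ᵥ x) ^ 2) (stdNormal p) := fun a => by
    simpa only [sq] using integrable_dotProduct_mul_four a a w w
  simp_rw [e]
  rw [integral_const_mul, integral_sub (i _) (i _), integral_dotProduct_sq_mul_sq,
    integral_dotProduct_sq_mul_sq]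
  simp only [add_dotProduct, sub_dotProduct, dotProduct_add, dotProduct_sub]
  rw [dotProduct_comm v u]
  ring

end Normal

/-! ### Conditionally centred homoscedastic noise -/

section Noise

variable {Ω E : Type*} [MeasurableSpace Ω] [MeasurableSpace E] {μ : Measure Ω}
  [IsProbabilityMeasure μ] {x : Ω → E} {e : Ω → ℝ} {s : ℝ} {f g : E → ℝ}

/-- Homoscedasticity says that the measure with density `e²`, pushed forward by `x`, is `s` times
the law of `x`. Stated for nonnegative `h` it needs no integrability of the product, so it can be
used to prove that `f(x) e` is square integrable when `e` has only two moments. -/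
lemma lintegral_comp_mul_noise_sq (hx : Measurable x) (he : MemLp e 2 μ)
    (hs : μ[fun ω => e ω ^ 2 | MeasurableSpace.comap x inferInstance] =ᵐ[μ] fun _ => s)
    {h : E → ℝ≥0∞} (hh : Measurable h) :
    ∫⁻ ω, h (x ω) * ENNReal.ofReal (e ω ^ 2) ∂μ
      = ENNReal.ofReal s * ∫⁻ ω, h (x ω) ∂μ := by
  have hint : Integrable (fun ω => e ω ^ 2) μ := he.integrable_sq
  have hm : AEMeasurable (fun ω => ENNReal.ofReal (e ω ^ 2)) μ := hint.1.aemeasurable.ennreal_ofReal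
  have hmap : (μ.withDensity fun ω => ENNReal.ofReal (e ω ^ 2)).map x
      = ENNReal.ofReal s • μ.map x := by
    ext A hA
    rw [Measure.map_apply hx hA, withDensity_apply _ (hx hA), Measure.smul_apply,
      Measure.map_apply hx hA, smul_eq_mul,
      ← ofReal_integral_eq_lintegral_ofReal hint.integrableOn (.of_forall fun _ => sq_nonneg _),
      ← setIntegral_condExp hx.comap_le hint ⟨A, hA, rfl⟩,
      setIntegral_congr_ae (g := fun _ => s) (hx hA) (hs.mono fun ω hω _ => hω)]
    rw [setIntegral_const, smul_eq_mul, mul_comm, ENNReal.ofReal_mul' measureReal_nonneg,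
      ofReal_measureReal]
  have h1 := lintegral_map (μ := μ.withDensity fun ω => ENNReal.ofReal (e ω ^ 2)) hh hx
  rw [hmap, lintegral_smul_measure, lintegral_map hh hx,
    lintegral_withDensity_eq_lintegral_mul₀ hm (g := fun ω => h (x ω))
      (hh.comp hx).aemeasurable] at h1
  rw [← smul_eq_mul, h1]
  refine lintegral_congr fun ω => ?_
  simp [mul_comm]

lemma memLp_comp_mul_noise (hx : Measurable x) (he : MemLp e 2 μ)
    (hs : μ[fun ω => e ω ^ 2 | MeasurableSpace.comap x inferInstance] =ᵐ[μ] fun _ => s)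
    (hf : Measurable f) (hf2 : MemLp (fun ω => f (x ω)) 2 μ) :
    MemLp (fun ω => f (x ω) * e ω) 2 μ := by
  have hm : AEStronglyMeasurable (fun ω => f (x ω) * e ω) μ := hf2.1.mul he.1
  rw [memLp_two_iff_integrable_sq hm]
  refine ⟨hm.pow 2, ?_⟩
  rw [hasFiniteIntegral_iff_ofReal (.of_forall fun _ => sq_nonneg _)]
  have h1 := lintegral_comp_mul_noise_sq hx he hs (h := fun y => ENNReal.ofReal (f y ^ 2))
    (by fun_prop)
  simp_rw [mul_pow, ENNReal.ofReal_mul (sq_nonneg _)]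
  rw [h1]
  exact ENNReal.mul_lt_top ENNReal.ofReal_lt_top
    ((hasFiniteIntegral_iff_ofReal (.of_forall fun _ => sq_nonneg _)).1 hf2.integrable_sq.2)

lemma integral_comp_mul_noise (hx : Measurable x) (he : MemLp e 2 μ)
    (h0 : μ[e | MeasurableSpace.comap x inferInstance] =ᵐ[μ] fun _ => 0)
    (hf : Measurable f) (hfe : Integrable (fun ω => f (x ω) * e ω) μ) :
    ∫ ω, f (x ω) * e ω ∂μ = 0 := by
  have hsm : StronglyMeasurable[MeasurableSpace.comap x inferInstance] (fun ω => f (x ω)) :=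
    (hf.comp (comap_measurable x)).stronglyMeasurable
  have := condExp_mul_of_stronglyMeasurable_left hsm hfe (he.integrable (by norm_num))
  rw [← integral_condExp hx.comap_le]
  refine (integral_congr_ae this).trans ?_
  refine integral_eq_zero_of_ae ?_
  filter_upwards [h0] with ω hω
  simp [hω]

lemma integral_comp_mul_noise_mul (hx : Measurable x) (he : MemLp e 2 μ)
    (hs : μ[fun ω => e ω ^ 2 | MeasurableSpace.comap x inferInstance] =ᵐ[μ] fun _ => s)
    (hf : Measurable f) (hf2 : MemLp (fun ω => f (x ω)) 2 μ)
    (hg : Measurable g) (hg2 : MemLp (fun ω => g (x ω)) 2 μ) :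
    ∫ ω, (f (x ω) * e ω) * (g (x ω) * e ω) ∂μ = s * ∫ ω, f (x ω) * g (x ω) ∂μ := by
  have hsm : StronglyMeasurable[MeasurableSpace.comap x inferInstance]
      (fun ω => f (x ω) * g (x ω)) :=
    ((hf.mul hg).comp (comap_measurable x)).stronglyMeasurable
  have e1 : (fun ω => (f (x ω) * e ω) * (g (x ω) * e ω))
      = (fun ω => f (x ω) * g (x ω)) * fun ω => e ω ^ 2 := by
    ext ω; simp only [Pi.mul_apply]; ring
  have hint := (memLp_comp_mul_noise hx he hs hf hf2).integrable_mul
    (memLp_comp_mul_noise hx he hs hg hg2)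
  have hint' : Integrable (fun ω => (f (x ω) * e ω) * (g (x ω) * e ω)) μ := hint
  rw [e1] at hint' ⊢
  have := condExp_mul_of_stronglyMeasurable_left hsm hint' he.integrable_sq
  rw [← integral_condExp hx.comap_le, ← integral_const_mul]
  refine (integral_congr_ae this).trans ?_
  refine integral_congr_ae ?_
  filter_upwards [hs] with ω hω
  simp [hω, mul_comm]

end Noise

/-! ### Products of functions of independent observations -/

section Kernel

variable {Ω E : Type*} [MeasurableSpace Ω] [MeasurableSpace E] {μ : Measure Ω} {n m m' : ℕ}

/-- The product kernel `∏ r, F r (V (e r))`. -/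
def kernelProd (F : Fin m → E → ℝ) (V : Fin n → Ω → E) (e : Fin m → Fin n) (ω : Ω) : ℝ :=
  ∏ r, F r (V (e r) ω)

variable {V : Fin n → Ω → E} {F : Fin m → E → ℝ} {F' : Fin m' → E → ℝ}
  {e : Fin m → Fin n} {e' : Fin m' → Fin n}

lemma measurable_kernelProd (hV : ∀ i, Measurable (V i)) (hF : ∀ r, Measurable (F r)) :
    Measurable (kernelProd F V e) := by
  unfold kernelProd
  exact Finset.measurable_fun_prod _ fun r _ => (hF r).comp (hV _)

/-- Both products are regrouped by observation: observation `i` collects the slots that `e` and `e'`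
send to `i`. Independence then factors the integral. -/
lemma integral_kernelProd_mul (hind : iIndepFun V μ) (hV : ∀ i, Measurable (V i))
    (hF : ∀ r, Measurable (F r)) (hF' : ∀ r, Measurable (F' r)) :
    ∫ ω, kernelProd F V e ω * kernelProd F' V e' ω ∂μ
      = ∏ i, ∫ ω, (∏ r with e r = i, F r (V i ω)) * ∏ r with e' r = i, F' r (V i ω) ∂μ := by
  rw [← hind.integral_fun_prod_comp
    (f := fun i y => (∏ r with e r = i, F r y) * ∏ r with e' r = i, F' r y)
    (fun i => (hV i).aemeasurable)]
  · refine integral_congr_ae (.of_forall fun ω => ?_)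
    simp only [kernelProd, Finset.prod_mul_distrib]
    congr 1
    · rw [← Finset.prod_fiberwise (s := Finset.univ) (g := e)]
      refine Finset.prod_congr rfl fun i _ => Finset.prod_congr rfl fun r hr => ?_
      rw [(Finset.mem_filter.1 hr).2]
    · rw [← Finset.prod_fiberwise (s := Finset.univ) (g := e')]
      refine Finset.prod_congr rfl fun i _ => Finset.prod_congr rfl fun r hr => ?_
      rw [(Finset.mem_filter.1 hr).2]
  · intro i
    exact ((Finset.measurable_fun_prod _ fun r _ => hF r).mul
      (Finset.measurable_fun_prod _ fun r _ => hF' r)).aestronglyMeasurable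

/-- The observation `e r` fills exactly one slot of the first kernel and none of the second, so its
factor is the mean of `F r`, which is 0. -/
lemma integral_kernelProd_mul_eq_zero (hind : iIndepFun V μ) (hV : ∀ i, Measurable (V i))
    (hF : ∀ r, Measurable (F r)) (hF' : ∀ r, Measurable (F' r)) (he : Function.Injective e)
    (h0 : ∀ r i, ∫ ω, F r (V i ω) ∂μ = 0) {r : Fin m} (hr : ∀ r', e' r' ≠ e r) :
    ∫ ω, kernelProd F V e ω * kernelProd F' V e' ω ∂μ = 0 := by
  rw [integral_kernelProd_mul hind hV hF hF']
  refine Finset.prod_eq_zero (Finset.mem_univ (e r)) ?_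
  have h1 : (Finset.univ.filter fun r₁ => e r₁ = e r) = {r} := by
    ext r₁; simp [he.eq_iff]
  have h2 : (Finset.univ.filter fun r₁ => e' r₁ = e r) = ∅ := by
    ext r₁; simp [hr r₁]
  simp [h1, h2, h0]

lemma integral_kernelProd_mul_eq_zero_of_range_ne (hind : iIndepFun V μ)
    (hV : ∀ i, Measurable (V i)) (hF : ∀ r, Measurable (F r)) (hF' : ∀ r, Measurable (F' r))
    (he : Function.Injective e) (he' : Function.Injective e')
    (h0 : ∀ r i, ∫ ω, F r (V i ω) ∂μ = 0) (h0' : ∀ r i, ∫ ω, F' r (V i ω) ∂μ = 0)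
    (hne : Finset.univ.image e ≠ Finset.univ.image e') :
    ∫ ω, kernelProd F V e ω * kernelProd F' V e' ω ∂μ = 0 := by
  by_cases h : ∃ r, ∀ r', e' r' ≠ e r
  · obtain ⟨r, hr⟩ := h
    exact integral_kernelProd_mul_eq_zero hind hV hF hF' he h0 hr
  by_cases h' : ∃ r', ∀ r, e r ≠ e' r'
  · obtain ⟨r', hr'⟩ := h'
    simp_rw [mul_comm (kernelProd F V e _)]
    exact integral_kernelProd_mul_eq_zero hind hV hF' hF he' h0' hr'
  push Not at h h'
  refine absurd ?_ hne
  ext i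
  simp only [Finset.mem_image, Finset.mem_univ, true_and]
  exact ⟨fun ⟨r, hr⟩ => (h r).imp fun _ => hr ▸ id, fun ⟨r, hr⟩ => (h' r).imp fun _ => hr ▸ id⟩

/-- The square is a product of nonnegative independent factors, so its Lebesgue integral factors
before anything is known to be integrable. This is why no moments beyond the second are needed. -/
lemma memLp_kernelProd (hind : iIndepFun V μ) (hV : ∀ i, Measurable (V i))
    (hF : ∀ r, Measurable (F r)) (he : Function.Injective e)
    (hL : ∀ r i, MemLp (fun ω => F r (V i ω)) 2 μ) : MemLp (kernelProd F V e) 2 μ := by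
  have hm : AEStronglyMeasurable (kernelProd F V e) μ :=
    (measurable_kernelProd hV hF).aestronglyMeasurable
  rw [memLp_two_iff_integrable_sq hm]
  refine ⟨hm.pow 2, ?_⟩
  rw [hasFiniteIntegral_iff_ofReal (.of_forall fun _ => sq_nonneg _)]
  have hi : iIndepFun (fun r ω => ENNReal.ofReal (F r (V (e r) ω) ^ 2)) μ :=
    (hind.precomp he).comp (fun r y => ENNReal.ofReal (F r y ^ 2))
      fun r => ((hF r).pow_const 2).ennreal_ofReal
  have h1 := lintegral_prod_eq_prod_lintegral_of_indepFun Finset.univ _ hi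
    fun r => (((hF r).comp (hV (e r))).pow_const 2).ennreal_ofReal
  have h2 : ∀ ω, ENNReal.ofReal (kernelProd F V e ω ^ 2)
      = ∏ r, ENNReal.ofReal (F r (V (e r) ω) ^ 2) := by
    intro ω
    rw [kernelProd, ← Finset.prod_pow, ENNReal.ofReal_prod_of_nonneg fun _ _ => sq_nonneg _]
  simp_rw [h2]
  rw [h1]
  refine ENNReal.prod_lt_top fun r _ => ?_
  exact (hasFiniteIntegral_iff_ofReal (.of_forall fun _ => sq_nonneg _)).1
    (hL r (e r)).integrable_sq.2

lemma integral_kernelProd_mul_self (hind : iIndepFun V μ) (hV : ∀ i, Measurable (V i))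
    {G : Fin m → E → ℝ} (hF : ∀ r, Measurable (F r)) (hG : ∀ r, Measurable (G r))
    (he : Function.Injective e) :
    ∫ ω, kernelProd F V e ω * kernelProd G V e ω ∂μ
      = ∏ r, ∫ ω, F r (V (e r) ω) * G r (V (e r) ω) ∂μ := by
  rw [← (hind.precomp he).integral_fun_prod_comp (f := fun r y => F r y * G r y)
    (fun i => (hV _).aemeasurable) fun r => ((hF r).mul (hG r)).aestronglyMeasurable]
  simp only [kernelProd, Finset.prod_mul_distrib]

end Kernel

/-! ### Second moments of sums of partially orthogonal families -/

section Sums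

variable {Ω ι κ : Type*} [MeasurableSpace Ω] {μ : Measure Ω} {s : Finset ι} {h : ι → Ω → ℝ}

lemma integral_sum_mul_sum {ι' : Type*} {s' : Finset ι'} {h' : ι' → Ω → ℝ}
    (hL : ∀ a ∈ s, MemLp (h a) 2 μ) (hL' : ∀ a ∈ s', MemLp (h' a) 2 μ) :
    ∫ ω, (∑ a ∈ s, h a ω) * (∑ b ∈ s', h' b ω) ∂μ
      = ∑ a ∈ s, ∑ b ∈ s', ∫ ω, h a ω * h' b ω ∂μ := by
  have hi : ∀ a ∈ s, ∀ b ∈ s', Integrable (fun ω => h a ω * h' b ω) μ := fun a ha b hb =>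
    (hL a ha).integrable_mul (hL' b hb)
  simp_rw [Finset.sum_mul_sum]
  rw [integral_finsetSum _ fun a ha => integrable_finsetSum _ (hi a ha)]
  exact Finset.sum_congr rfl fun a ha => integral_finsetSum _ (hi a ha)

lemma integral_mul_le_of_sq_le {f g : Ω → ℝ} (hf : MemLp f 2 μ) (hg : MemLp g 2 μ) {K : ℝ}
    (hfK : ∫ ω, f ω ^ 2 ∂μ ≤ K) (hgK : ∫ ω, g ω ^ 2 ∂μ ≤ K) : ∫ ω, f ω * g ω ∂μ ≤ K := by
  have h1 : ∫ ω, f ω * g ω ∂μ ≤ ∫ ω, 2⁻¹ * (f ω ^ 2 + g ω ^ 2) ∂μ := by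
    refine integral_mono (hf.integrable_mul hg)
      ((hf.integrable_sq.add hg.integrable_sq).const_mul _) fun ω => ?_
    simp only
    nlinarith [sq_nonneg (f ω - g ω)]
  rw [integral_const_mul, integral_add hf.integrable_sq hg.integrable_sq] at h1
  linarith

/-- In the expanded square a fixed summand interacts only with those of the same `supp`, at most `m`
of them, and each such cross moment is at most `K`. -/
lemma integral_sum_sq_le [DecidableEq κ] (supp : ι → κ) {K : ℝ} {m : ℕ}
    (hL : ∀ a ∈ s, MemLp (h a) 2 μ) (hK : ∀ a ∈ s, ∫ ω, h a ω ^ 2 ∂μ ≤ K)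
    (horth : ∀ a ∈ s, ∀ b ∈ s, supp a ≠ supp b → ∫ ω, h a ω * h b ω ∂μ = 0)
    (hfib : ∀ a ∈ s, (s.filter fun b => supp b = supp a).card ≤ m) :
    ∫ ω, (∑ a ∈ s, h a ω) ^ 2 ∂μ ≤ s.card * (m * K) := by
  simp_rw [sq (∑ a ∈ s, h a _)]
  rw [integral_sum_mul_sum hL hL, ← nsmul_eq_mul]
  refine Finset.sum_le_card_nsmul _ _ _ fun a ha => ?_
  have hK0 : 0 ≤ K := (integral_nonneg fun _ => sq_nonneg _).trans (hK a ha)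
  rw [← Finset.sum_filter_add_sum_filter_not s fun b => supp b = supp a,
    Finset.sum_eq_zero (s := s.filter fun b => ¬ supp b = supp a)
      (fun b hb => horth a ha b (Finset.mem_filter.1 hb).1 (Ne.symm (Finset.mem_filter.1 hb).2)),
    add_zero]
  calc _ ≤ ∑ b ∈ s.filter fun b => supp b = supp a, K := Finset.sum_le_sum fun b hb =>
        integral_mul_le_of_sq_le (hL a ha) (hL b (Finset.mem_filter.1 hb).1) (hK a ha)
          (hK b (Finset.mem_filter.1 hb).1)
    _ ≤ m * K := by
        rw [Finset.sum_const, nsmul_eq_mul]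
        exact mul_le_mul_of_nonneg_right (by exact_mod_cast hfib a ha) hK0

end Sums

/-! ### Second moments of the summands -/

section Moments

variable {n p : ℕ}

/-- The centred product `(uᵀ x) y - uᵀ β`, as a function of an observation. -/
def linScore (β u : Fin p → ℝ) (d : (Fin p → ℝ) × ℝ) : ℝ := (u ⬝ᵥ d.1) * d.2 - u ⬝ᵥ β

/-- The centred quadratic form `(uᵀ x) (vᵀ x) - uᵀ v`, as a function of an observation. -/
def quadScore (u v : Fin p → ℝ) (d : (Fin p → ℝ) × ℝ) : ℝ := (u ⬝ᵥ d.1) * (v ⬝ᵥ d.1) - u ⬝ᵥ v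

lemma measurable_dotProduct_left (u : Fin p → ℝ) : Measurable fun x : Fin p → ℝ => u ⬝ᵥ x := by
  unfold dotProduct; fun_prop

lemma measurable_linScore (β u : Fin p → ℝ) : Measurable (linScore β u) :=
  (((measurable_dotProduct_left u).comp measurable_fst).mul measurable_snd).sub_const _

lemma measurable_quadScore (u v : Fin p → ℝ) : Measurable (quadScore u v) :=
  (((measurable_dotProduct_left u).comp measurable_fst).mul
    ((measurable_dotProduct_left v).comp measurable_fst)).sub_const _

variable {Ω : Type*} [MeasurableSpace Ω] {μ : Measure Ω} [IsProbabilityMeasure μ]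
  {β : Fin p → ℝ} {s : ℝ} {X : Fin n → Ω → Fin p → ℝ} {Y : Fin n → Ω → ℝ}

lemma response_eq (i : Fin n) (ω : Ω) : Y i ω = β ⬝ᵥ X i ω + noise β X Y i ω := by
  simp [noise, dotProduct]

lemma integral_noise_sq (h : IsLinearModel μ β s X Y) (i : Fin n) :
    ∫ ω, noise β X Y i ω ^ 2 ∂μ = s := by
  rw [← integral_condExp (h.measurable_X i).comap_le, integral_congr_ae (h.condExp_noise_sq i)]
  simp

variable (h : IsLinearModel μ β s X Y) (hg : ∀ i, μ.map (X i) = stdNormal p)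

include h hg

lemma integral_comp_design (i : Fin n) {f : (Fin p → ℝ) → ℝ} (hf : Measurable f) :
    ∫ ω, f (X i ω) ∂μ = ∫ x, f x ∂stdNormal p := by
  rw [← hg i, integral_map (h.measurable_X i).aemeasurable hf.aestronglyMeasurable]

lemma memLp_comp_design (i : Fin n) {f : (Fin p → ℝ) → ℝ} (hf : Measurable f) {q : ℝ≥0∞}
    (hL : MemLp f q (stdNormal p)) : MemLp (fun ω => f (X i ω)) q μ := by
  rw [← hg i, memLp_map_measure_iff hf.aestronglyMeasurable (h.measurable_X i).aemeasurable] at hL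
  exact hL

/-- Moments of `f(X) + g(X) ε`. -/
lemma moments_add_mul_noise (i : Fin n) {f g f' g' : (Fin p → ℝ) → ℝ}
    (hf : Measurable f) (hg' : Measurable g) (hf' : Measurable f') (hg'' : Measurable g')
    (hfL : MemLp f 2 (stdNormal p)) (hgL : MemLp g 2 (stdNormal p))
    (hfL' : MemLp f' 2 (stdNormal p)) (hgL' : MemLp g' 2 (stdNormal p)) :
    MemLp (fun ω => f (X i ω) + g (X i ω) * noise β X Y i ω) 2 μ ∧
    ∫ ω, f (X i ω) + g (X i ω) * noise β X Y i ω ∂μ = ∫ x, f x ∂stdNormal p ∧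
    ∫ ω, (f (X i ω) + g (X i ω) * noise β X Y i ω) *
        (f' (X i ω) + g' (X i ω) * noise β X Y i ω) ∂μ
      = (∫ x, f x * f' x ∂stdNormal p) + s * ∫ x, g x * g' x ∂stdNormal p := by
  have hx := h.measurable_X i
  have he := h.memLp_noise i
  have h0 := h.condExp_noise i
  have hs := h.condExp_noise_sq i
  have a1 := memLp_comp_design h hg i hf hfL
  have a2 := memLp_comp_design h hg i hf' hfL'
  have b1 := memLp_comp_design h hg i hg' hgL
  have b2 := memLp_comp_design h hg i hg'' hgL'
  have c1 := memLp_comp_mul_noise hx he hs hg' b1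
  have c2 := memLp_comp_mul_noise hx he hs hg'' b2
  refine ⟨a1.add c1, ?_, ?_⟩
  · rw [integral_add (a1.integrable (by norm_num)) (c1.integrable (by norm_num)),
      integral_comp_mul_noise hx he h0 hg' (c1.integrable (by norm_num)), add_zero,
      integral_comp_design h hg i hf]
  · have e : ∀ ω, (f (X i ω) + g (X i ω) * noise β X Y i ω) *
        (f' (X i ω) + g' (X i ω) * noise β X Y i ω)
        = f (X i ω) * f' (X i ω) + (f (X i ω) * g' (X i ω)) * noise β X Y i ω
          + (f' (X i ω) * g (X i ω)) * noise β X Y i ω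
          + (g (X i ω) * noise β X Y i ω) * (g' (X i ω) * noise β X Y i ω) := fun ω => by ring
    have i1 : Integrable (fun ω => f (X i ω) * f' (X i ω)) μ := a1.integrable_mul a2
    have i2 : Integrable (fun ω => (f (X i ω) * g' (X i ω)) * noise β X Y i ω) μ := by
      simpa only [mul_assoc, Pi.mul_def] using a1.integrable_mul c2
    have i3 : Integrable (fun ω => (f' (X i ω) * g (X i ω)) * noise β X Y i ω) μ := by
      simpa only [mul_assoc, Pi.mul_def] using a2.integrable_mul c1
    have i4 : Integrable (fun ω => (g (X i ω) * noise β X Y i ω) *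
      (g' (X i ω) * noise β X Y i ω)) μ := c1.integrable_mul c2
    simp_rw [e]
    rw [integral_add ((i1.fun_add i2).fun_add i3) i4, integral_add (i1.fun_add i2) i3,
      integral_add i1 i2,
      integral_comp_mul_noise hx he h0 (f := fun x => f x * g' x) (hf.mul hg'') i2,
      integral_comp_mul_noise hx he h0 (f := fun x => f' x * g x) (hf'.mul hg') i3,
      integral_comp_mul_noise_mul hx he hs hg' b1 hg'' b2,
      integral_comp_design h hg i (f := fun x => f x * f' x) (hf.mul hf'),
      integral_comp_design h hg i (f := fun x => g x * g' x) (hg'.mul hg'')]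
    ring

omit h hg in
lemma linScore_eq (u : Fin p → ℝ) (i : Fin n) (ω : Ω) :
    linScore β u (X i ω, Y i ω)
      = ((u ⬝ᵥ X i ω) * (β ⬝ᵥ X i ω) - u ⬝ᵥ β) + (u ⬝ᵥ X i ω) * noise β X Y i ω := by
  simp only [linScore]
  rw [response_eq (β := β) (X := X) (Y := Y) i ω]
  ring

omit h hg in
lemma quadScore_eq (u v : Fin p → ℝ) (i : Fin n) (ω : Ω) :
    quadScore u v (X i ω, Y i ω)
      = ((u ⬝ᵥ X i ω) * (v ⬝ᵥ X i ω) - u ⬝ᵥ v) + (0 : ℝ) * noise β X Y i ω := by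
  simp [quadScore]

omit h hg in
lemma memLp_quad (u v : Fin p → ℝ) :
    MemLp (fun x => (u ⬝ᵥ x) * (v ⬝ᵥ x) - u ⬝ᵥ v) 2 (stdNormal p) :=
  (memLp_dotProduct_mul u v).sub (memLp_const _)

omit h hg in
lemma measurable_quad (u v : Fin p → ℝ) :
    Measurable fun x : Fin p → ℝ => (u ⬝ᵥ x) * (v ⬝ᵥ x) - u ⬝ᵥ v :=
  ((measurable_dotProduct_left u).mul (measurable_dotProduct_left v)).sub_const _

omit h hg in
lemma memLp_dotProduct_two (u : Fin p → ℝ) :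
    MemLp (fun x => u ⬝ᵥ x) 2 (stdNormal p) :=
  memLp_dotProduct u 2

omit h hg in
lemma integral_quad (u v : Fin p → ℝ) :
    ∫ x, (u ⬝ᵥ x) * (v ⬝ᵥ x) - u ⬝ᵥ v ∂stdNormal p = 0 := by
  rw [integral_sub (integrable_dotProduct_mul u v) (integrable_const _),
    integral_dotProduct_mul]
  simp

omit h hg in
lemma integral_quad_mul_quad (u v w z : Fin p → ℝ) :
    ∫ x, ((u ⬝ᵥ x) * (v ⬝ᵥ x) - u ⬝ᵥ v) * ((w ⬝ᵥ x) * (z ⬝ᵥ x) - w ⬝ᵥ z) ∂stdNormal p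
      = (∫ x, (u ⬝ᵥ x) * (v ⬝ᵥ x) * ((w ⬝ᵥ x) * (z ⬝ᵥ x)) ∂stdNormal p)
        - (u ⬝ᵥ v) * (w ⬝ᵥ z) := by
  have e : ∀ x, ((u ⬝ᵥ x) * (v ⬝ᵥ x) - u ⬝ᵥ v) * ((w ⬝ᵥ x) * (z ⬝ᵥ x) - w ⬝ᵥ z)
      = (u ⬝ᵥ x) * (v ⬝ᵥ x) * ((w ⬝ᵥ x) * (z ⬝ᵥ x))
        - (w ⬝ᵥ z) * ((u ⬝ᵥ x) * (v ⬝ᵥ x)) - (u ⬝ᵥ v) * ((w ⬝ᵥ x) * (z ⬝ᵥ x) - w ⬝ᵥ z) :=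
    fun x => by ring
  simp_rw [e]
  have i1 := integrable_dotProduct_mul_four u v w z
  have i2 := (integrable_dotProduct_mul u v).const_mul (w ⬝ᵥ z)
  have i3 := ((memLp_quad w z).integrable (by norm_num)).const_mul (u ⬝ᵥ v)
  rw [integral_sub (i1.sub' i2) i3, integral_sub i1 i2, integral_const_mul, integral_const_mul,
    integral_quad, integral_dotProduct_mul]
  ring

lemma memLp_linScore (u : Fin p → ℝ) (i : Fin n) :
    MemLp (fun ω => linScore β u (X i ω, Y i ω)) 2 μ := by
  simp_rw [linScore_eq]
  exact (moments_add_mul_noise h hg i (measurable_quad u β) (measurable_dotProduct_left u)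
    measurable_const measurable_const (memLp_quad u β) (memLp_dotProduct_two u) (memLp_const 0)
    (memLp_const 0)).1

lemma integral_linScore (u : Fin p → ℝ) (i : Fin n) :
    ∫ ω, linScore β u (X i ω, Y i ω) ∂μ = 0 := by
  simp_rw [linScore_eq]
  rw [(moments_add_mul_noise h hg i (measurable_quad u β) (measurable_dotProduct_left u)
    measurable_const measurable_const (memLp_quad u β) (memLp_dotProduct_two u) (memLp_const 0)
    (memLp_const 0)).2.1, integral_quad]

/-- The design contributes `(u·v)(β·β) + 2(u·β)(v·β)` from the Gaussian fourth moment, less the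
product of the means; the noise contributes `s (u·v)`. -/
lemma integral_linScore_mul_linScore (u v : Fin p → ℝ) (i : Fin n) :
    ∫ ω, linScore β u (X i ω, Y i ω) * linScore β v (X i ω, Y i ω) ∂μ
      = (u ⬝ᵥ v) * (β ⬝ᵥ β + s) + (u ⬝ᵥ β) * (v ⬝ᵥ β) := by
  simp_rw [linScore_eq]
  rw [(moments_add_mul_noise h hg i (measurable_quad u β) (measurable_dotProduct_left u)
    (measurable_quad v β) (measurable_dotProduct_left v) (memLp_quad u β)
    (memLp_dotProduct_two u) (memLp_quad v β) (memLp_dotProduct_two v)).2.2,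
    integral_quad_mul_quad, integral_dotProduct_mul]
  have e : ∀ x, (u ⬝ᵥ x) * (β ⬝ᵥ x) * ((v ⬝ᵥ x) * (β ⬝ᵥ x))
      = (u ⬝ᵥ x) * (v ⬝ᵥ x) * (β ⬝ᵥ x) ^ 2 := fun x => by ring
  simp_rw [e]
  rw [integral_dotProduct_mul_mul_sq]
  ring

lemma memLp_quadScore (u v : Fin p → ℝ) (i : Fin n) :
    MemLp (fun ω => quadScore u v (X i ω, Y i ω)) 2 μ :=
  memLp_comp_design h hg i (measurable_quad u v) (memLp_quad u v)

lemma integral_quadScore (u v : Fin p → ℝ) (i : Fin n) :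
    ∫ ω, quadScore u v (X i ω, Y i ω) ∂μ = 0 :=
  (integral_comp_design h hg i (measurable_quad u v)).trans (integral_quad u v)

lemma integral_quadScore_sq (u v : Fin p → ℝ) (i : Fin n) :
    ∫ ω, quadScore u v (X i ω, Y i ω) ^ 2 ∂μ = (u ⬝ᵥ u) * (v ⬝ᵥ v) + (u ⬝ᵥ v) ^ 2 := by
  refine (integral_comp_design h hg i ((measurable_quad u v).pow_const 2)).trans ?_
  simp_rw [sq ((u ⬝ᵥ _) * (v ⬝ᵥ _) - u ⬝ᵥ v)]
  have e : ∀ x, (u ⬝ᵥ x) * (v ⬝ᵥ x) * ((u ⬝ᵥ x) * (v ⬝ᵥ x))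
      = (u ⬝ᵥ x) ^ 2 * (v ⬝ᵥ x) ^ 2 := fun x => by ring
  rw [integral_quad_mul_quad]
  simp_rw [e]
  rw [integral_dotProduct_sq_mul_sq]
  ring

lemma integral_linScore_mul_quadScore (u w : Fin p → ℝ) (i : Fin n) :
    ∫ ω, linScore β u (X i ω, Y i ω) * quadScore w w (X i ω, Y i ω) ∂μ
      = 2 * (u ⬝ᵥ w) * (β ⬝ᵥ w) := by
  simp_rw [quadScore_eq (β := β), linScore_eq]
  rw [(moments_add_mul_noise h hg i (measurable_quad u β) (measurable_dotProduct_left u)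
    (measurable_quad w w) (g' := fun _ => 0) measurable_const (memLp_quad u β)
    (memLp_dotProduct_two u) (memLp_quad w w) (memLp_const 0)).2.2,
    integral_quad_mul_quad]
  have e : ∀ x, (u ⬝ᵥ x) * (β ⬝ᵥ x) * ((w ⬝ᵥ x) * (w ⬝ᵥ x))
      = (u ⬝ᵥ x) * (β ⬝ᵥ x) * (w ⬝ᵥ x) ^ 2 := fun x => by ring
  simp_rw [e]
  rw [integral_dotProduct_mul_mul_sq]
  simp

end Moments

/-! ### Sums over tuples of distinct indices -/

section DistinctSums

variable {n : ℕ}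

/-- The sum of `a i * b k` over `i ≠ k`. -/
def pairSum (a b : Fin n → ℝ) : ℝ := ∑ i, ∑ k, if i ≠ k then a i * b k else 0

/-- The sum of `a i * b k * c l` over pairwise distinct `i`, `k`, `l`. -/
def tripleSum (a b c : Fin n → ℝ) : ℝ :=
  ∑ i, ∑ k, ∑ l, if i ≠ k ∧ i ≠ l ∧ k ≠ l then a i * b k * c l else 0

lemma pairSum_eq (a b : Fin n → ℝ) :
    pairSum a b = (∑ i, a i) * (∑ i, b i) - ∑ i, a i * b i := by
  have e : ∀ i k : Fin n, (if i ≠ k then a i * b k else 0)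
      = a i * b k - if i = k then a i * b k else 0 := by
    intro i k; by_cases h : i = k <;> simp [h]
  simp only [pairSum, e, Finset.sum_sub_distrib, Finset.sum_ite_eq, Finset.mem_univ, if_true,
    ← Finset.mul_sum, ← Finset.sum_mul]

/-- Inclusion–exclusion over coinciding indices. A triple with all three indices equal is removed
three times, hence the correction by twice the diagonal sum. -/
lemma tripleSum_eq (a b c : Fin n → ℝ) :
    tripleSum a b c = (∑ i, a i) * (∑ i, b i) * (∑ i, c i) - (∑ i, a i * b i) * (∑ i, c i)
      - (∑ i, a i * c i) * (∑ i, b i) - (∑ i, b i * c i) * (∑ i, a i)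
      + 2 * ∑ i, a i * b i * c i := by
  have e : ∀ i k : Fin n, ∑ l, (if i ≠ k ∧ i ≠ l ∧ k ≠ l then a i * b k * c l else 0)
      = if i ≠ k then a i * b k * (∑ l, c l) - a i * c i * b k - a i * (b k * c k) else 0 := by
    intro i k
    by_cases h : i = k
    · simp [h]
    · have e' : ∀ l, (if i ≠ k ∧ i ≠ l ∧ k ≠ l then a i * b k * c l else 0)
          = a i * b k * c l - (if i = l then a i * b k * c l else 0)
            - if k = l then a i * b k * c l else 0 := by
        intro l
        by_cases h1 : i = l
        · have : k ≠ l := fun h2 => h (h1.trans h2.symm)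
          simp [h1, this]
        · by_cases h2 : k = l <;> simp [h, h1, h2]
      rw [Finset.sum_congr rfl fun l _ => e' l]
      simp only [Finset.sum_sub_distrib, Finset.sum_ite_eq, Finset.mem_univ, if_true, h,
        ne_eq, not_false_eq_true, ← Finset.mul_sum]
      ring
  have e2 : tripleSum a b c = (∑ l, c l) * pairSum a b - pairSum (fun i => a i * c i) b
      - pairSum a fun i => b i * c i := by
    simp only [tripleSum, e]
    generalize ∑ l, c l = C
    simp only [pairSum, Finset.mul_sum, ← Finset.sum_sub_distrib]
    refine Finset.sum_congr rfl fun i _ => Finset.sum_congr rfl fun k _ => ?_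
    split_ifs <;> ring
  have e3 : ∑ i, a i * c i * b i = ∑ i, a i * b i * c i :=
    Finset.sum_congr rfl fun i _ => by ring
  have e4 : ∑ i, a i * (b i * c i) = ∑ i, a i * b i * c i :=
    Finset.sum_congr rfl fun i _ => by ring
  rw [e2, pairSum_eq, pairSum_eq, pairSum_eq, e3, e4]
  ring

lemma pairSum_add_const (a b : Fin n → ℝ) (α α' : ℝ) :
    pairSum (fun i => a i + α) (fun i => b i + α')
      = pairSum a b + ((n : ℝ) - 1) * (α * ∑ i, b i + α' * ∑ i, a i)
        + n * ((n : ℝ) - 1) * (α * α') := by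
  have e : ∀ i, (a i + α) * (b i + α') = a i * b i + α' * a i + α * b i + α * α' :=
    fun i => by ring
  simp only [pairSum_eq, e, Finset.sum_add_distrib, ← Finset.mul_sum, Finset.sum_const,
    Finset.card_univ, Fintype.card_fin, nsmul_eq_mul]
  ring

/-- This is the Hoeffding expansion of the kernel when `α` and `α'` are means. The factors `n - 1`
and `n - 2` count the choices of the indices left free; the third entry is not shifted because it
will already be centred. -/
lemma tripleSum_add_const (a b c : Fin n → ℝ) (α α' : ℝ) :
    tripleSum (fun i => a i + α) (fun i => b i + α') c
      = tripleSum a b c + ((n : ℝ) - 2) * (α * pairSum b c + α' * pairSum a c)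
        + ((n : ℝ) - 1) * ((n : ℝ) - 2) * (α * α' * ∑ i, c i) := by
  have e : ∀ i, (a i + α) * (b i + α') = a i * b i + α' * a i + α * b i + α * α' :=
    fun i => by ring
  have e1 : ∀ i, (a i + α) * c i = a i * c i + α * c i := fun i => by ring
  have e2 : ∀ i, (b i + α') * c i = b i * c i + α' * c i := fun i => by ring
  have e3 : ∀ i, (a i + α) * (b i + α') * c i
      = a i * b i * c i + α' * (a i * c i) + α * (b i * c i) + α * α' * c i := fun i => by ring
  simp only [tripleSum_eq, pairSum_eq, e3]
  simp only [e, e1, e2, Finset.sum_add_distrib, ← Finset.mul_sum,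
    Finset.sum_const, Finset.card_univ, Fintype.card_fin, nsmul_eq_mul]
  ring

lemma pairSum_eq_sum_offDiag (a b : Fin n → ℝ) :
    pairSum a b = ∑ q ∈ (Finset.univ : Finset (Fin n)).offDiag, a q.1 * b q.2 := by
  have : (Finset.univ : Finset (Fin n)).offDiag = Finset.univ.filter fun q => q.1 ≠ q.2 := by
    ext q; simp
  rw [this, Finset.sum_filter, Fintype.sum_prod_type]
  rfl

lemma tripleSum_eq_sum_filter (a b c : Fin n → ℝ) :
    tripleSum a b c = ∑ q : Fin n × Fin n × Fin n with
      q.1 ≠ q.2.1 ∧ q.1 ≠ q.2.2 ∧ q.2.1 ≠ q.2.2, a q.1 * b q.2.1 * c q.2.2 := by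
  rw [Finset.sum_filter, Fintype.sum_prod_type]
  simp_rw [Fintype.sum_prod_type]
  rfl

end DistinctSums

/-! ### Second moments of degenerate U-statistics -/

section UStatistics

variable {Ω E : Type*} [MeasurableSpace Ω] [MeasurableSpace E] {μ : Measure Ω} {n m : ℕ}
  {V : Fin n → Ω → E}

/-- Kernels on different index sets are orthogonal, so the second moment has the order `n^m` of the
number of tuples rather than its square. -/
lemma integral_sum_kernelProd_sq_le {ι : Type*} {S : Finset ι} {e : ι → Fin m → Fin n}
    {F : Fin m → E → ℝ} (hind : iIndepFun V μ) (hV : ∀ i, Measurable (V i))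
    (hF : ∀ r, Measurable (F r)) (hL : ∀ r i, MemLp (fun ω => F r (V i ω)) 2 μ)
    (h0 : ∀ r i, ∫ ω, F r (V i ω) ∂μ = 0) {K : Fin m → ℝ}
    (hK : ∀ r i, ∫ ω, F r (V i ω) ^ 2 ∂μ ≤ K r)
    (hK0 : ∀ r, 0 ≤ K r) (he : Function.Injective e) (hei : ∀ a ∈ S, Function.Injective (e a)) :
    ∫ ω, (∑ a ∈ S, kernelProd F V (e a) ω) ^ 2 ∂μ ≤ (n : ℝ) ^ m * ((m : ℝ) ^ m * ∏ r, K r) := by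
  classical
  have hKp : 0 ≤ ∏ r, K r := Finset.prod_nonneg fun r _ => hK0 r
  have hsq : ∀ a ∈ S, ∫ ω, kernelProd F V (e a) ω ^ 2 ∂μ ≤ ∏ r, K r := by
    intro a ha
    simp_rw [sq (kernelProd F V (e a) _)]
    rw [integral_kernelProd_mul_self hind hV hF hF (hei a ha)]
    refine Finset.prod_le_prod (fun r _ => integral_nonneg fun _ => mul_self_nonneg _)
      fun r _ => ?_
    simpa only [sq] using hK r (e a r)
  have key := integral_sum_sq_le (μ := μ) (s := S) (h := fun a => kernelProd F V (e a))
    (m := m ^ m) (fun a => Finset.univ.image (e a))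
    (fun a ha => memLp_kernelProd hind hV hF (hei a ha) hL) hsq
    (fun a ha b hb hab => integral_kernelProd_mul_eq_zero_of_range_ne hind hV hF hF
      (hei a ha) (hei b hb) h0 h0 hab)
    (fun a ha => by
      -- Tuples with a given image are maps from `m` slots into a set of `m` indices. The crude
      -- count `m ^ m` replaces `m!` and produces the factors 4 and 27 for pairs and triples.
      have hc : (Fintype.piFinset fun _ : Fin m => Finset.univ.image (e a)).card = m ^ m := by
        simp [Finset.card_image_of_injective _ (hei a ha)]
      rw [← hc]
      refine Finset.card_le_card_of_injOn e (fun b hb => ?_) he.injOn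
      have hb' := (Finset.mem_filter.1 hb).2
      refine Fintype.mem_piFinset.2 fun r => ?_
      rw [← hb']
      exact Finset.mem_image_of_mem _ (Finset.mem_univ _))
  refine key.trans ?_
  push_cast
  have hcard : (S.card : ℝ) ≤ (n : ℝ) ^ m := by
    have : S.card ≤ (Finset.univ : Finset (Fin m → Fin n)).card :=
      Finset.card_le_card_of_injOn e (fun _ _ => Finset.mem_coe.2 (Finset.mem_univ _)) he.injOn
    simp only [Finset.card_univ, Fintype.card_pi, Fintype.card_fin, Finset.prod_const] at this
    exact_mod_cast this
  gcongr

variable (hind : iIndepFun V μ) (hV : ∀ i, Measurable (V i))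
include hind hV

lemma integral_pairSum_sq_le {f g : E → ℝ} (hf : Measurable f) (hg : Measurable g)
    (hfL : ∀ i, MemLp (fun ω => f (V i ω)) 2 μ) (hgL : ∀ i, MemLp (fun ω => g (V i ω)) 2 μ)
    (hf0 : ∀ i, ∫ ω, f (V i ω) ∂μ = 0) (hg0 : ∀ i, ∫ ω, g (V i ω) ∂μ = 0) {K L : ℝ}
    (hfK : ∀ i, ∫ ω, f (V i ω) ^ 2 ∂μ ≤ K) (hgL' : ∀ i, ∫ ω, g (V i ω) ^ 2 ∂μ ≤ L)
    (hK : 0 ≤ K) (hL : 0 ≤ L) :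
    ∫ ω, pairSum (fun i => f (V i ω)) (fun i => g (V i ω)) ^ 2 ∂μ
      ≤ (n : ℝ) ^ 2 * (4 * (K * L)) := by
  have := integral_sum_kernelProd_sq_le (S := (Finset.univ : Finset (Fin n)).offDiag)
    (e := fun q => ![q.1, q.2]) (F := ![f, g]) (K := ![K, L]) hind hV
    (by simp [Fin.forall_fin_two, hf, hg]) (by simp [Fin.forall_fin_two, hfL, hgL])
    (by simp [Fin.forall_fin_two, hf0, hg0]) (by simp [Fin.forall_fin_two, hfK, hgL'])
    (by simp [Fin.forall_fin_two, hK, hL])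
    (by
      rintro ⟨a, b⟩ ⟨c, d⟩ h
      have h0 := congrFun h 0
      have h1 := congrFun h 1
      simp_all)
    (by
      rintro ⟨a, b⟩ h
      have hab : a ≠ b := by simpa using h
      intro i j hij
      fin_cases i <;> fin_cases j <;> simp_all [eq_comm])
  simp only [kernelProd, Fin.prod_univ_two, Matrix.cons_val_zero, Matrix.cons_val_one] at this
  simp_rw [pairSum_eq_sum_offDiag]
  refine this.trans_eq ?_
  norm_num

lemma integral_tripleSum_sq_le {f g k : E → ℝ} (hf : Measurable f) (hg : Measurable g)
    (hk : Measurable k) (hfL : ∀ i, MemLp (fun ω => f (V i ω)) 2 μ)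
    (hgL : ∀ i, MemLp (fun ω => g (V i ω)) 2 μ) (hkL : ∀ i, MemLp (fun ω => k (V i ω)) 2 μ)
    (hf0 : ∀ i, ∫ ω, f (V i ω) ∂μ = 0) (hg0 : ∀ i, ∫ ω, g (V i ω) ∂μ = 0)
    (hk0 : ∀ i, ∫ ω, k (V i ω) ∂μ = 0) {K L M : ℝ}
    (hfK : ∀ i, ∫ ω, f (V i ω) ^ 2 ∂μ ≤ K) (hgL' : ∀ i, ∫ ω, g (V i ω) ^ 2 ∂μ ≤ L)
    (hkM : ∀ i, ∫ ω, k (V i ω) ^ 2 ∂μ ≤ M) (hK : 0 ≤ K) (hL : 0 ≤ L) (hM : 0 ≤ M) :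
    ∫ ω, tripleSum (fun i => f (V i ω)) (fun i => g (V i ω)) (fun i => k (V i ω)) ^ 2 ∂μ
      ≤ (n : ℝ) ^ 3 * (27 * (K * L * M)) := by
  have := integral_sum_kernelProd_sq_le (S := Finset.univ.filter
      fun q : Fin n × Fin n × Fin n => q.1 ≠ q.2.1 ∧ q.1 ≠ q.2.2 ∧ q.2.1 ≠ q.2.2)
    (e := fun q => ![q.1, q.2.1, q.2.2]) (F := ![f, g, k]) (K := ![K, L, M]) hind hV
    (by simp [Fin.forall_fin_succ, hf, hg, hk]) (by simp [Fin.forall_fin_succ, hfL, hgL, hkL])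
    (by simp [Fin.forall_fin_succ, hf0, hg0, hk0])
    (by simp [Fin.forall_fin_succ, hfK, hgL', hkM])
    (by simp [Fin.forall_fin_succ, hK, hL, hM])
    (by
      rintro ⟨a, b, b'⟩ ⟨c, d, d'⟩ h
      have h0 := congrFun h 0
      have h1 := congrFun h 1
      have h2 := congrFun h 2
      simp_all)
    (by
      rintro ⟨a, b, c⟩ h
      obtain ⟨h1, h2, h3⟩ : a ≠ b ∧ a ≠ c ∧ b ≠ c := by simpa using h
      intro i j hij
      fin_cases i <;> fin_cases j <;> simp_all [eq_comm])
  simp only [kernelProd, Fin.prod_univ_three, Matrix.cons_val_zero, Matrix.cons_val_one,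
    Matrix.cons_val_two, Matrix.head_cons, Matrix.tail_cons] at this
  simp_rw [tripleSum_eq_sum_filter]
  refine this.trans_eq ?_
  norm_num

end UStatistics

/-! ### Exact second moments of sums and pair sums -/

section ExactMoments

variable {Ω E : Type*} [MeasurableSpace Ω] [MeasurableSpace E] {μ : Measure Ω} {n : ℕ}
  {V : Fin n → Ω → E}

lemma pair_vec_injective {a b : Fin n} (hab : a ≠ b) : Function.Injective ![a, b] := by
  intro i j hij
  fin_cases i <;> fin_cases j <;> simp_all [eq_comm]

lemma kernelProd_single (f : E → ℝ) (i : Fin n) (ω : Ω) :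
    kernelProd ![f] V ![i] ω = f (V i ω) := by
  simp [kernelProd]

lemma kernelProd_pair (f g : E → ℝ) (i k : Fin n) (ω : Ω) :
    kernelProd ![f, g] V ![i, k] ω = f (V i ω) * g (V k ω) := by
  simp [kernelProd]

variable (hind : iIndepFun V μ) (hV : ∀ i, Measurable (V i)) {f g : E → ℝ} (hf : Measurable f)
  (hg : Measurable g) (hfL : ∀ i, MemLp (fun ω => f (V i ω)) 2 μ)
  (hgL : ∀ i, MemLp (fun ω => g (V i ω)) 2 μ) (hf0 : ∀ i, ∫ ω, f (V i ω) ∂μ = 0)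
  (hg0 : ∀ i, ∫ ω, g (V i ω) ∂μ = 0)

include hfL in
lemma memLp_sum_comp : MemLp (fun ω => ∑ i, f (V i ω)) 2 μ :=
  memLp_finsetSum _ fun i _ => hfL i

include hfL hf0 in
lemma integral_sum_comp [IsProbabilityMeasure μ] : ∫ ω, ∑ i, f (V i ω) ∂μ = 0 := by
  rw [integral_finsetSum _ fun i _ => (hfL i).integrable (by norm_num)]
  exact Finset.sum_eq_zero fun i _ => hf0 i

include hind hV hf hfL hf0 in
lemma integral_sum_comp_sq {c : ℝ} (hc : ∀ i, ∫ ω, f (V i ω) ^ 2 ∂μ = c) :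
    ∫ ω, (∑ i, f (V i ω)) ^ 2 ∂μ = n * c := by
  simp_rw [sq (∑ i, f (V i _))]
  rw [integral_sum_mul_sum (fun i _ => hfL i) (fun i _ => hfL i)]
  have e : ∀ i k : Fin n, ∫ ω, f (V i ω) * f (V k ω) ∂μ = if i = k then c else 0 := by
    intro i k
    split_ifs with h
    · subst h
      simpa only [sq] using hc i
    · simp_rw [← kernelProd_single (V := V) f]
      exact integral_kernelProd_mul_eq_zero hind hV (by simp [hf]) (by simp [hf])
        (Function.injective_of_subsingleton _) (by simp [hf0]) (r := 0)
        (fun r' => by simpa using Ne.symm h)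
  simp [e]

include hind hV hf hg hfL hgL in
lemma memLp_mul_comp {i k : Fin n} (hik : i ≠ k) :
    MemLp (fun ω => f (V i ω) * g (V k ω)) 2 μ := by
  have := memLp_kernelProd (F := ![f, g]) hind hV (by simp [Fin.forall_fin_two, hf, hg])
    (pair_vec_injective hik) (by simp [Fin.forall_fin_two, hfL, hgL])
  exact (memLp_congr_ae (.of_forall fun ω => kernelProd_pair f g i k ω)).1 this

include hind hV hf hg hfL hgL in
lemma memLp_pairSum :
    MemLp (fun ω => pairSum (fun i => f (V i ω)) (fun i => g (V i ω))) 2 μ := by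
  simp_rw [pairSum_eq_sum_offDiag]
  exact memLp_finsetSum _ fun q hq =>
    memLp_mul_comp hind hV hf hg hfL hgL (Finset.mem_offDiag.1 hq).2.2

include hind hV hf hg hfL hgL hf0 in
lemma integral_pairSum [IsProbabilityMeasure μ] :
    ∫ ω, pairSum (fun i => f (V i ω)) (fun i => g (V i ω)) ∂μ = 0 := by
  simp_rw [pairSum_eq_sum_offDiag]
  rw [integral_finsetSum _ fun q hq => (memLp_mul_comp hind hV hf hg hfL hgL
    (Finset.mem_offDiag.1 hq).2.2).integrable (by norm_num)]
  refine Finset.sum_eq_zero fun q hq => ?_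
  rw [(hind.indepFun (Finset.mem_offDiag.1 hq).2.2).integral_fun_comp_mul_comp
    (hV _).aemeasurable (hV _).aemeasurable hf.aestronglyMeasurable hg.aestronglyMeasurable,
    hf0, zero_mul]

include hind hV hf hg hfL hgL hg0 in
-- One index cannot meet both members of a pair of distinct indices, so some centred factor `g`
-- always stands alone.
lemma integral_sum_comp_mul_pairSum :
    ∫ ω, (∑ i, f (V i ω)) * pairSum (fun i => g (V i ω)) (fun i => g (V i ω)) ∂μ = 0 := by
  simp_rw [pairSum_eq_sum_offDiag]
  rw [integral_sum_mul_sum (h' := fun q ω => g (V q.1 ω) * g (V q.2 ω)) (fun i _ => hfL i)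
    fun q hq => memLp_mul_comp hind hV hg hg hgL hgL (Finset.mem_offDiag.1 hq).2.2]
  refine Finset.sum_eq_zero fun i _ => Finset.sum_eq_zero fun q hq => ?_
  have hq' := (Finset.mem_offDiag.1 hq).2.2
  simp_rw [← kernelProd_single (V := V) f, ← kernelProd_pair (V := V) g g]
  simp_rw [mul_comm (kernelProd ![f] V _ _)]
  have H : ∀ r : Fin 2, (∀ r', ![i] r' ≠ ![q.1, q.2] r) →
      ∫ ω, kernelProd ![g, g] V ![q.1, q.2] ω * kernelProd ![f] V ![i] ω ∂μ = 0 :=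
    fun r hr => integral_kernelProd_mul_eq_zero hind hV (by simp [Fin.forall_fin_two, hg])
      (by simp [hf]) (pair_vec_injective hq') (by simp [Fin.forall_fin_two, hg0]) hr
  by_cases h : i = q.1
  · exact H 1 fun r' => by simpa [h] using hq'
  · exact H 0 fun r' => by simpa using h

include hind hV hf hg hfL hgL hf0 in
-- A pair correlates only with itself and with its reversal, each contributing `c ^ 2`; this gives
-- the factor 2 times the `n(n-1)` ordered pairs.
lemma integral_pairSum_mul_pairSum {c : ℝ} (hc : ∀ i, ∫ ω, f (V i ω) * g (V i ω) ∂μ = c) :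
    ∫ ω, pairSum (fun i => f (V i ω)) (fun i => f (V i ω)) *
        pairSum (fun i => g (V i ω)) (fun i => g (V i ω)) ∂μ
      = 2 * (n * ((n : ℝ) - 1)) * c ^ 2 := by
  simp_rw [pairSum_eq_sum_offDiag]
  rw [integral_sum_mul_sum (h := fun q ω => f (V q.1 ω) * f (V q.2 ω))
    (h' := fun q ω => g (V q.1 ω) * g (V q.2 ω))
    (fun q hq => memLp_mul_comp hind hV hf hf hfL hfL (Finset.mem_offDiag.1 hq).2.2)
    fun q hq => memLp_mul_comp hind hV hg hg hgL hgL (Finset.mem_offDiag.1 hq).2.2]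
  have hself : ∀ q : Fin n × Fin n, q.1 ≠ q.2 →
      ∫ ω, (f (V q.1 ω) * f (V q.2 ω)) * (g (V q.1 ω) * g (V q.2 ω)) ∂μ = c ^ 2 := by
    intro q hq
    simp_rw [← kernelProd_pair (V := V)]
    rw [integral_kernelProd_mul_self hind hV (by simp [Fin.forall_fin_two, hf])
      (by simp [Fin.forall_fin_two, hg]) (pair_vec_injective hq)]
    simp [hc, sq]
  have e : ∀ q ∈ (Finset.univ : Finset (Fin n)).offDiag,
      ∀ q' ∈ (Finset.univ : Finset (Fin n)).offDiag,
      ∫ ω, (f (V q.1 ω) * f (V q.2 ω)) * (g (V q'.1 ω) * g (V q'.2 ω)) ∂μ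
        = (if q = q' then c ^ 2 else 0) + if q.swap = q' then c ^ 2 else 0 := by
    rintro ⟨a, b⟩ hq ⟨a', b'⟩ hq'
    have hab : a ≠ b := (Finset.mem_offDiag.1 hq).2.2
    have hab' : a' ≠ b' := (Finset.mem_offDiag.1 hq').2.2
    simp only [Prod.swap_prod_mk, Prod.mk.injEq]
    by_cases h1 : a = a' ∧ b = b'
    · obtain ⟨rfl, rfl⟩ := h1
      have : ¬ (b = a ∧ a = b) := fun h => hab h.2
      simpa [this] using hself (a, b) hab
    by_cases h2 : b = a' ∧ a = b'
    · obtain ⟨rfl, rfl⟩ := h2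
      simp only [h1, if_false, zero_add, and_self, if_true]
      simp_rw [mul_comm (g (V b _))]
      exact hself (a, b) hab
    simp only [h1, h2, if_false, add_zero]
    simp_rw [← kernelProd_pair (V := V)]
    have H : ∀ r : Fin 2, (∀ r', ![a', b'] r' ≠ ![a, b] r) →
        ∫ ω, kernelProd ![f, f] V ![a, b] ω * kernelProd ![g, g] V ![a', b'] ω ∂μ = 0 :=
      fun r hr => integral_kernelProd_mul_eq_zero hind hV (by simp [Fin.forall_fin_two, hf])
        (by simp [Fin.forall_fin_two, hg]) (pair_vec_injective hab)
        (by simp [Fin.forall_fin_two, hf0]) hr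
    by_cases h3 : a = a' ∨ a = b'
    · refine H 1 ?_
      simp only [Fin.forall_fin_two, Matrix.cons_val_zero, Matrix.cons_val_one]
      grind
    · refine H 0 ?_
      simp only [Fin.forall_fin_two, Matrix.cons_val_zero, Matrix.cons_val_one]
      grind
  rw [Finset.sum_congr rfl fun q hq => Finset.sum_congr rfl (e q hq)]
  have e2 : ∀ q ∈ (Finset.univ : Finset (Fin n)).offDiag,
      ∑ q' ∈ (Finset.univ : Finset (Fin n)).offDiag,
        ((if q = q' then c ^ 2 else 0) + if q.swap = q' then c ^ 2 else 0) = 2 * c ^ 2 := by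
    intro q hq
    have hs : q.swap ∈ (Finset.univ : Finset (Fin n)).offDiag := by
      have := (Finset.mem_offDiag.1 hq).2.2
      simpa using this.symm
    rw [Finset.sum_add_distrib, Finset.sum_ite_eq, Finset.sum_ite_eq, if_pos hq, if_pos hs]
    ring
  rw [Finset.sum_congr rfl e2, Finset.sum_const, Finset.offDiag_card, Finset.card_univ,
    Fintype.card_fin, nsmul_eq_mul, Nat.cast_sub (Nat.le_mul_self n)]
  push_cast
  ring

end ExactMoments

/-! ### Variance of a linear plus degenerate quadratic statistic -/

section Projection

variable {Ω E ι : Type*} [MeasurableSpace Ω] [MeasurableSpace E] {μ : Measure Ω}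
  [IsProbabilityMeasure μ] {n : ℕ} {V : Fin n → Ω → E}

/-- A linear statistic plus a degenerate quadratic statistic. -/
noncomputable def linQuadStat (f : E → ℝ) (z : ι → E → ℝ) (S : Finset ι) (V : Fin n → Ω → E)
    (ω : Ω) : ℝ :=
  2 / (n : ℝ) * (∑ i, f (V i ω)) +
    1 / ((n : ℝ) * ((n : ℝ) - 1)) * ∑ j ∈ S, pairSum (fun i => z j (V i ω)) (fun i => z j (V i ω))

lemma moments_linQuadStat {f : E → ℝ} {z : ι → E → ℝ} {S : Finset ι} (hn : 2 ≤ n)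
    (hind : iIndepFun V μ) (hV : ∀ i, Measurable (V i)) (hf : Measurable f)
    (hz : ∀ j, Measurable (z j)) (hfL : ∀ i, MemLp (fun ω => f (V i ω)) 2 μ)
    (hzL : ∀ j i, MemLp (fun ω => z j (V i ω)) 2 μ) (hf0 : ∀ i, ∫ ω, f (V i ω) ∂μ = 0)
    (hz0 : ∀ j i, ∫ ω, z j (V i ω) ∂μ = 0) {v : ℝ} (hv : ∀ i, ∫ ω, f (V i ω) ^ 2 ∂μ = v)
    {c : ι → ι → ℝ} (hc : ∀ j j' i, ∫ ω, z j (V i ω) * z j' (V i ω) ∂μ = c j j') :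
    MemLp (linQuadStat f z S V) 2 μ ∧ ∫ ω, linQuadStat f z S V ω ∂μ = 0 ∧
    ∫ ω, linQuadStat f z S V ω ^ 2 ∂μ
      = 4 / n * v + 2 / (n * ((n : ℝ) - 1)) * ∑ j ∈ S, ∑ j' ∈ S, c j j' ^ 2 := by
  have hn0 : (n : ℝ) ≠ 0 := by positivity
  have hn1 : (n : ℝ) - 1 ≠ 0 := by
    have : (2 : ℝ) ≤ n := by exact_mod_cast hn
    linarith
  have hA := memLp_sum_comp (V := V) hfL
  have hP : ∀ j, MemLp (fun ω => pairSum (fun i => z j (V i ω)) (fun i => z j (V i ω))) 2 μ :=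
    fun j => memLp_pairSum hind hV (hz j) (hz j) (hzL j) (hzL j)
  have hD : MemLp (fun ω => ∑ j ∈ S, pairSum (fun i => z j (V i ω)) (fun i => z j (V i ω))) 2 μ :=
    memLp_finsetSum _ fun j _ => hP j
  have hA' := hA.const_mul (2 / (n : ℝ))
  have hD' := hD.const_mul (1 / ((n : ℝ) * ((n : ℝ) - 1)))
  refine ⟨hA'.add hD', ?_, ?_⟩
  · simp only [linQuadStat]
    rw [integral_add (hA'.integrable (by norm_num)) (hD'.integrable (by norm_num)),
      integral_const_mul, integral_const_mul, integral_sum_comp hfL hf0,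
      integral_finsetSum _ fun j _ => (hP j).integrable (by norm_num),
      Finset.sum_eq_zero fun j _ => integral_pairSum hind hV (hz j) (hz j) (hzL j) (hzL j) (hz0 j)]
    simp
  · have e : ∀ ω, linQuadStat f z S V ω ^ 2
        = (2 / (n : ℝ)) ^ 2 * (∑ i, f (V i ω)) ^ 2
          + (2 * (2 / (n : ℝ)) * (1 / ((n : ℝ) * ((n : ℝ) - 1)))) * ((∑ i, f (V i ω)) *
            ∑ j ∈ S, pairSum (fun i => z j (V i ω)) (fun i => z j (V i ω)))
          + (1 / ((n : ℝ) * ((n : ℝ) - 1))) ^ 2 *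
            ((∑ j ∈ S, pairSum (fun i => z j (V i ω)) (fun i => z j (V i ω))) *
              ∑ j ∈ S, pairSum (fun i => z j (V i ω)) (fun i => z j (V i ω))) := by
      intro ω; rw [linQuadStat]; ring
    have i1 := hA.integrable_sq.const_mul ((2 / (n : ℝ)) ^ 2)
    have i2 := (hA.integrable_mul hD).const_mul
      (2 * (2 / (n : ℝ)) * (1 / ((n : ℝ) * ((n : ℝ) - 1))))
    have i3 := (hD.integrable_mul hD).const_mul ((1 / ((n : ℝ) * ((n : ℝ) - 1))) ^ 2)
    simp only [Pi.mul_apply] at i2 i3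
    simp_rw [e]
    rw [integral_add (i1.fun_add i2) i3, integral_add i1 i2, integral_const_mul,
      integral_const_mul, integral_const_mul, integral_sum_comp_sq hind hV hf hfL hf0 hv,
      integral_sum_mul_sum (fun j _ => hP j) (fun j _ => hP j),
      Finset.sum_congr rfl fun j _ => Finset.sum_congr rfl fun j' _ =>
        integral_pairSum_mul_pairSum hind hV (hz j) (hz j') (hzL j) (hzL j') (hz0 j) (hc j j')]
    have e2 : ∫ ω, (∑ i, f (V i ω)) *
        ∑ j ∈ S, pairSum (fun i => z j (V i ω)) (fun i => z j (V i ω)) ∂μ = 0 := by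
      have hi : ∀ j ∈ S, Integrable (fun ω => (∑ i, f (V i ω)) *
          pairSum (fun i => z j (V i ω)) (fun i => z j (V i ω))) μ :=
        fun j _ => hA.integrable_mul (hP j)
      simp_rw [Finset.mul_sum S]
      rw [integral_finsetSum _ hi]
      exact Finset.sum_eq_zero fun j _ =>
        integral_sum_comp_mul_pairSum hind hV hf (hz j) hfL (hzL j) (hz0 j)
    rw [e2]
    simp_rw [← Finset.mul_sum]
    field_simp
    ring

end Projection

/-! ### Hoeffding decompositions of the estimators -/

section Decomposition

variable {n p : ℕ}

/-- The restriction of the coefficient vector to `S`. -/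
def coeffOn (β : Fin p → ℝ) (S : Finset (Fin p)) (j : Fin p) : ℝ := if j ∈ S then β j else 0

/-- The centred version of `W_{ij}`, as a function of an observation. -/
noncomputable def coordScore (β : Fin p → ℝ) (j : Fin p) : (Fin p → ℝ) × ℝ → ℝ :=
  linScore β (Pi.single j 1)

/-- The centred product of two covariates, as a function of an observation. -/
noncomputable def coordQuad (j j' : Fin p) : (Fin p → ℝ) × ℝ → ℝ :=
  quadScore (Pi.single j 1) (Pi.single j' 1)

/-- The linear term of `T_S`. -/
noncomputable def influence (β : Fin p → ℝ) (S : Finset (Fin p)) (d : (Fin p → ℝ) × ℝ) : ℝ :=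
  linScore β β d - quadScore (coeffOn β S) (coeffOn β S) d

/-- The degenerate part of `ψ̂_{jj'}`. -/
noncomputable def psiRem (β : Fin p → ℝ) (x : Fin n → Fin p → ℝ) (y : Fin n → ℝ) (j j' : Fin p) :
    ℝ :=
  1 / ((n : ℝ) * ((n : ℝ) - 1)) * β j *
      pairSum (fun i => coordScore β j' (x i, y i)) (fun i => coordQuad j j' (x i, y i)) +
    1 / ((n : ℝ) * ((n : ℝ) - 1)) * β j' *
      pairSum (fun i => coordScore β j (x i, y i)) (fun i => coordQuad j j' (x i, y i)) +
    1 / ((n : ℝ) * ((n : ℝ) - 1) * ((n : ℝ) - 2)) *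
      tripleSum (fun i => coordScore β j (x i, y i)) (fun i => coordScore β j' (x i, y i))
        (fun i => coordQuad j j' (x i, y i))

variable (β : Fin p → ℝ) (S : Finset (Fin p)) (x : Fin n → Fin p → ℝ) (y : Fin n → ℝ)

lemma W_eq (i : Fin n) (j : Fin p) : W x y i j = coordScore β j (x i, y i) + β j := by
  simp [W, coordScore, linScore]

lemma coeffOn_univ : coeffOn β Finset.univ = β := by
  ext j; simp [coeffOn]

lemma coeffOn_dotProduct (v : Fin p → ℝ) : coeffOn β S ⬝ᵥ v = ∑ j ∈ S, β j * v j := by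
  simp [coeffOn, dotProduct, Finset.sum_ite_mem]

lemma dotProduct_coeffOn_self : β ⬝ᵥ coeffOn β S = coeffOn β S ⬝ᵥ coeffOn β S := by
  rw [coeffOn_dotProduct, dotProduct_comm, coeffOn_dotProduct]
  exact Finset.sum_congr rfl fun j hj => by simp [coeffOn, hj]

lemma coeffOn_dotProduct_self : coeffOn β S ⬝ᵥ coeffOn β S = ∑ j ∈ S, β j ^ 2 := by
  rw [coeffOn_dotProduct]
  exact Finset.sum_congr rfl fun j hj => by simp [coeffOn, hj, sq]

lemma sum_mul_coordScore (d : (Fin p → ℝ) × ℝ) :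
    ∑ j ∈ S, β j * coordScore β j d = linScore β (coeffOn β S) d := by
  simp only [linScore, coordScore, coeffOn_dotProduct, single_one_dotProduct, mul_sub,
    Finset.sum_sub_distrib, Finset.sum_mul, mul_assoc]

lemma sum_sum_mul_coordQuad (d : (Fin p → ℝ) × ℝ) :
    ∑ j ∈ S, ∑ j' ∈ S, β j * β j' * coordQuad j j' d
      = quadScore (coeffOn β S) (coeffOn β S) d := by
  simp only [quadScore, coordQuad, coeffOn_dotProduct, single_one_dotProduct, mul_sub,
    Finset.sum_sub_distrib, Finset.sum_mul_sum]
  congr 1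
  · exact Finset.sum_congr rfl fun j _ => Finset.sum_congr rfl fun j' _ => by ring
  · refine Finset.sum_congr rfl fun j hj => ?_
    simp [Pi.single_apply, coeffOn, hj]

variable {β S x y}

lemma betaSqHat_eq (hn : 2 ≤ n) (j : Fin p) :
    betaSqHat x y j = β j ^ 2 + 2 / (n : ℝ) * (β j * ∑ i, coordScore β j (x i, y i)) +
      1 / ((n : ℝ) * ((n : ℝ) - 1)) *
        pairSum (fun i => coordScore β j (x i, y i)) (fun i => coordScore β j (x i, y i)) := by
  have hn0 : (n : ℝ) ≠ 0 := by positivity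
  have hn1 : (n : ℝ) - 1 ≠ 0 := by
    have : (2 : ℝ) ≤ n := by exact_mod_cast hn
    linarith
  have : betaSqHat x y j = 1 / ((n : ℝ) * ((n : ℝ) - 1)) *
      pairSum (fun i => W x y i j) (fun i => W x y i j) := rfl
  rw [this]
  simp_rw [W_eq β]
  rw [pairSum_add_const]
  field_simp
  ring

/-- The identity is purely algebraic, so the dataset is treated as a random sample on the one-point
space `Unit`; evaluating a genuine sample at `ω` gives the same expression by definition. -/
lemma tauSqHatOn_eq (hn : 2 ≤ n) :
    tauSqHatOn x y S = (∑ j ∈ S, β j ^ 2) +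
      linQuadStat (linScore β (coeffOn β S)) (coordScore β) S (fun i _ => (x i, y i)) () := by
  simp only [tauSqHatOn, betaSqHat_eq (β := β) hn, linQuadStat, Finset.sum_add_distrib,
    ← Finset.mul_sum, ← sum_mul_coordScore]
  rw [Finset.sum_comm (s := Finset.univ)]
  simp only [← Finset.mul_sum]
  ring

/-- Only the product of the two means `β j` and `β j'` leaves a nondegenerate term, since the third
factor of the kernel is centred. Everything else is collected in `psiRem`. -/
lemma psiHat_eq (hn : 3 ≤ n) (j j' : Fin p) :
    psiHat (stdNormal p) x y j j'
      = 1 / (n : ℝ) * (β j * β j' * ∑ i, coordQuad j j' (x i, y i)) + psiRem β x y j j' := by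
  have hn3 : (3 : ℝ) ≤ n := by exact_mod_cast hn
  have hn0 : (n : ℝ) ≠ 0 := by linarith
  have hn1 : (n : ℝ) - 1 ≠ 0 := by linarith
  have hn2 : (n : ℝ) - 2 ≠ 0 := by linarith
  have hq : ∀ i, x i j * x i j' - ∫ x : Fin p → ℝ, x j * x j' ∂stdNormal p
      = coordQuad j j' (x i, y i) := by
    intro i
    have := integral_dotProduct_mul (p := p) (Pi.single j 1) (Pi.single j' 1)
    simp only [single_one_dotProduct] at this
    simp [coordQuad, quadScore, this, Pi.single_apply, eq_comm]
  have : psiHat (stdNormal p) x y j j' = 1 / ((n : ℝ) * ((n : ℝ) - 1) * ((n : ℝ) - 2)) *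
      tripleSum (fun i => W x y i j) (fun i => W x y i j')
        (fun i => coordQuad j j' (x i, y i)) := by
    simp only [psiHat, tripleSum, hq]
  rw [this]
  simp_rw [W_eq β]
  rw [tripleSum_add_const, psiRem]
  field_simp
  ring

/-- Summed over `S × S`, the linear parts of the zero-estimators form one quadratic score of
`coeffOn β S`. The factor 2 in `T_S` matches the 2 of the linear term of `τ̂²`, so it is simply
subtracted in `influence`. -/
lemma TOn_eq (hn : 3 ≤ n) :
    TOn (stdNormal p) x y S = tauSq β +
      linQuadStat (influence β S) (coordScore β) Finset.univ (fun i _ => (x i, y i)) ()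
      - 2 * ∑ j ∈ S, ∑ j' ∈ S, psiRem β x y j j' := by
  have h1 : tauSqHat x y = tauSqHatOn x y Finset.univ := rfl
  have h2 : ∑ j ∈ S, ∑ j' ∈ S, psiHat (stdNormal p) x y j j'
      = 1 / (n : ℝ) * (∑ i, quadScore (coeffOn β S) (coeffOn β S) (x i, y i))
        + ∑ j ∈ S, ∑ j' ∈ S, psiRem β x y j j' := by
    simp only [psiHat_eq (β := β) hn, Finset.sum_add_distrib, ← Finset.mul_sum,
      ← sum_sum_mul_coordQuad]
    congr 2
    rw [Finset.sum_comm (s := Finset.univ)]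
    refine Finset.sum_congr rfl fun j _ => ?_
    rw [Finset.sum_comm (s := Finset.univ)]
    exact Finset.sum_congr rfl fun j' _ => Finset.mul_sum _ _ _
  rw [TOn, h1, h2, tauSqHatOn_eq (β := β) (by omega)]
  simp only [linQuadStat, influence, coeffOn_univ, tauSq, Finset.sum_sub_distrib]
  ring

end Decomposition

/-! ### Second moments of the estimators -/

section ModelMoments

variable {n p : ℕ} {Ω : Type*} [MeasurableSpace Ω] {μ : Measure Ω} [IsProbabilityMeasure μ]
  {β : Fin p → ℝ} {s : ℝ} {X : Fin n → Ω → Fin p → ℝ} {Y : Fin n → Ω → ℝ} {S : Finset (Fin p)}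

/-- The covariance of the coordinate scores. -/
def scoreCov (β : Fin p → ℝ) (s : ℝ) (j j' : Fin p) : ℝ :=
  (if j = j' then β ⬝ᵥ β + s else 0) + β j * β j'

lemma sum_scoreCov_sq (β : Fin p → ℝ) (s : ℝ) :
    ∑ j, ∑ j', scoreCov β s j j' ^ 2
      = p * (tauSq β + s) ^ 2 + 2 * (tauSq β + s) * tauSq β + tauSq β ^ 2 := by
  have ht : β ⬝ᵥ β = tauSq β := by simp [dotProduct, tauSq, sq]
  have e : ∀ j j' : Fin p, scoreCov β s j j' ^ 2
      = (if j = j' then (tauSq β + s) ^ 2 + 2 * (tauSq β + s) * (β j * β j') else 0)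
        + β j ^ 2 * β j' ^ 2 := by
    intro j j'
    rw [scoreCov, ht]
    split_ifs <;> ring
  simp only [e, Finset.sum_add_distrib, Finset.sum_ite_eq, Finset.mem_univ, if_true,
    ← Finset.mul_sum, ← Finset.sum_mul, Finset.sum_const, Finset.card_univ, Fintype.card_fin,
    nsmul_eq_mul, ← sq]
  simp only [← tauSq.eq_def]

lemma tauSq_eq_dotProduct (β : Fin p → ℝ) : tauSq β = β ⬝ᵥ β := by simp [dotProduct, tauSq, sq]

lemma sq_le_tauSq (β : Fin p → ℝ) (j : Fin p) : β j ^ 2 ≤ tauSq β :=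
  Finset.single_le_sum (f := fun j => β j ^ 2) (fun _ _ => sq_nonneg _) (Finset.mem_univ j)

lemma tauSq_nonneg (β : Fin p → ℝ) : 0 ≤ tauSq β := Finset.sum_nonneg fun _ _ => sq_nonneg _

lemma sum_sq_le_tauSq (β : Fin p → ℝ) (S : Finset (Fin p)) : ∑ j ∈ S, β j ^ 2 ≤ tauSq β :=
  Finset.sum_le_sum_of_subset_of_nonneg (Finset.subset_univ S) fun _ _ _ => sq_nonneg _

variable (h : IsLinearModel μ β s X Y) (hg : ∀ i, μ.map (X i) = stdNormal p)

include h

lemma measurable_obs (i : Fin n) : Measurable fun ω => (X i ω, Y i ω) :=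
  (h.measurable_X i).prodMk (h.measurable_Y i)

lemma sigmaSq_nonneg (hn : 0 < n) : 0 ≤ s := by
  rw [← integral_noise_sq h ⟨0, hn⟩]
  exact integral_nonneg fun _ => sq_nonneg _

include hg

lemma integral_coordScore_mul (j j' : Fin p) (i : Fin n) :
    ∫ ω, coordScore β j (X i ω, Y i ω) * coordScore β j' (X i ω, Y i ω) ∂μ
      = scoreCov β s j j' := by
  refine (integral_linScore_mul_linScore h hg _ _ i).trans ?_
  simp [scoreCov, Pi.single_apply, eq_comm]

lemma moments_tauSqHatOn (hn : 2 ≤ n) :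
    MemLp (fun ω => tauSqHatOn (fun i => X i ω) (fun i => Y i ω) S - ∑ j ∈ S, β j ^ 2) 2 μ ∧
    ∫ ω, (tauSqHatOn (fun i => X i ω) (fun i => Y i ω) S - ∑ j ∈ S, β j ^ 2) ^ 2 ∂μ
      = 4 / n * ((∑ j ∈ S, β j ^ 2) * (tauSq β + s) + (∑ j ∈ S, β j ^ 2) ^ 2)
        + 2 / (n * ((n : ℝ) - 1)) * ∑ j ∈ S, ∑ j' ∈ S, scoreCov β s j j' ^ 2 := by
  have key := moments_linQuadStat (S := S) hn h.indep (measurable_obs h)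
    (measurable_linScore β (coeffOn β S)) (fun j => measurable_linScore β (Pi.single j 1))
    (memLp_linScore h hg _) (fun j => memLp_linScore h hg _) (integral_linScore h hg _)
    (fun j => integral_linScore h hg _)
    (v := (∑ j ∈ S, β j ^ 2) * (tauSq β + s) + (∑ j ∈ S, β j ^ 2) ^ 2)
    (fun i => by
      simp_rw [sq (linScore β _ _)]
      rw [integral_linScore_mul_linScore h hg, dotProduct_comm (coeffOn β S) β,
        dotProduct_coeffOn_self, coeffOn_dotProduct_self, tauSq_eq_dotProduct]
      ring)
    (integral_coordScore_mul h hg)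
  have e : ∀ ω, tauSqHatOn (fun i => X i ω) (fun i => Y i ω) S - ∑ j ∈ S, β j ^ 2
      = linQuadStat (linScore β (coeffOn β S)) (coordScore β) S
        (fun i ω => (X i ω, Y i ω)) ω := by
    intro ω
    rw [tauSqHatOn_eq (β := β) hn, add_sub_cancel_left]
    rfl
  simp_rw [e]
  exact ⟨key.1, key.2.2⟩

/-- The zero-estimators change the variance of the linear score by `-4 τ_S⁴` through the covariance
and by `+2 τ_S⁴` through their own variance, hence the net `-2 τ_S⁴`. -/
lemma moments_leadingTerm (hn : 2 ≤ n) :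
    MemLp (linQuadStat (influence β S) (coordScore β) Finset.univ
      (fun i ω => (X i ω, Y i ω))) 2 μ ∧
    ∫ ω, linQuadStat (influence β S) (coordScore β) Finset.univ
      (fun i ω => (X i ω, Y i ω)) ω ∂μ = 0 ∧
    ∫ ω, linQuadStat (influence β S) (coordScore β) Finset.univ
      (fun i ω => (X i ω, Y i ω)) ω ^ 2 ∂μ
      = 4 / n * (tauSq β * (tauSq β + s) + tauSq β ^ 2 - 2 * (∑ j ∈ S, β j ^ 2) ^ 2)
        + 2 / (n * ((n : ℝ) - 1)) *
          (p * (tauSq β + s) ^ 2 + 2 * (tauSq β + s) * tauSq β + tauSq β ^ 2) := by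
  rw [← sum_scoreCov_sq]
  have a := memLp_linScore h hg β
  have b := memLp_quadScore h hg (coeffOn β S) (coeffOn β S)
  refine moments_linQuadStat (f := influence β S) hn h.indep (measurable_obs h)
    ((measurable_linScore β β).sub (measurable_quadScore (coeffOn β S) (coeffOn β S)))
    (fun j => measurable_linScore β (Pi.single j 1))
    (fun i => (a i).sub (b i)) (fun j => memLp_linScore h hg _) (fun i => ?_)
    (fun j => integral_linScore h hg _) (fun i => ?_) (integral_coordScore_mul h hg)
  · simp only [influence]
    rw [integral_sub ((a i).integrable (by norm_num)) ((b i).integrable (by norm_num)),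
      integral_linScore h hg, integral_quadScore h hg, sub_zero]
  · have e : ∀ ω, influence β S (X i ω, Y i ω) ^ 2
        = linScore β β (X i ω, Y i ω) * linScore β β (X i ω, Y i ω)
          - 2 * (linScore β β (X i ω, Y i ω) *
            quadScore (coeffOn β S) (coeffOn β S) (X i ω, Y i ω))
          + quadScore (coeffOn β S) (coeffOn β S) (X i ω, Y i ω) ^ 2 := by
      intro ω; rw [influence]; ring
    have i1 : Integrable (fun ω => linScore β β (X i ω, Y i ω) * linScore β β (X i ω, Y i ω)) μ :=
      (a i).integrable_mul (a i)
    have i2 : Integrable (fun ω => 2 * (linScore β β (X i ω, Y i ω) *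
        quadScore (coeffOn β S) (coeffOn β S) (X i ω, Y i ω))) μ :=
      ((a i).integrable_mul (b i)).const_mul 2
    simp_rw [e]
    rw [integral_add (i1.sub' i2) (b i).integrable_sq, integral_sub i1 i2, integral_const_mul,
      integral_linScore_mul_linScore h hg, integral_linScore_mul_quadScore h hg,
      integral_quadScore_sq h hg, dotProduct_coeffOn_self, coeffOn_dotProduct_self,
      ← tauSq_eq_dotProduct]
    ring

end ModelMoments

/-! ### Elementary integral inequalities -/

section Inequalities

variable {Ω : Type*} [MeasurableSpace Ω] {μ : Measure Ω} {f g h : Ω → ℝ}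

lemma abs_integral_mul_le_sqrt (hf : MemLp f 2 μ) (hg : MemLp g 2 μ) :
    |∫ ω, f ω * g ω ∂μ| ≤ √((∫ ω, f ω ^ 2 ∂μ) * ∫ ω, g ω ^ 2 ∂μ) := by
  refine Real.abs_le_sqrt ?_
  have hfg : Integrable (fun ω => f ω * g ω) μ := hf.integrable_mul hg
  have key : ∀ t : ℝ, 0 ≤ (∫ ω, g ω ^ 2 ∂μ) * (t * t) + (2 * ∫ ω, f ω * g ω ∂μ) * t
      + ∫ ω, f ω ^ 2 ∂μ := by
    intro t
    -- Cauchy–Schwarz from the discriminant of this nonnegative quadratic in `t`.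
    have h0 : 0 ≤ ∫ ω, (f ω + t * g ω) ^ 2 ∂μ := integral_nonneg fun _ => sq_nonneg _
    have e : ∀ ω, (f ω + t * g ω) ^ 2 = f ω ^ 2 + (2 * t) * (f ω * g ω) + t ^ 2 * g ω ^ 2 :=
      fun ω => by ring
    simp_rw [e] at h0
    rw [integral_add (hf.integrable_sq.fun_add (hfg.const_mul _)) (hg.integrable_sq.const_mul _),
      integral_add hf.integrable_sq (hfg.const_mul _), integral_const_mul, integral_const_mul] at h0
    linarith
  have := discrim_le_zero key
  rw [discrim] at this
  nlinarith

lemma sq_integral_le [IsProbabilityMeasure μ] (hf : MemLp f 2 μ) :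
    (∫ ω, f ω ∂μ) ^ 2 ≤ ∫ ω, f ω ^ 2 ∂μ := by
  have := variance_nonneg f μ
  rw [variance_eq_sub hf] at this
  simp only [Pi.pow_apply] at this
  linarith

lemma integral_abs_le_sqrt [IsProbabilityMeasure μ] (hf : MemLp f 2 μ) :
    ∫ ω, |f ω| ∂μ ≤ √(∫ ω, f ω ^ 2 ∂μ) := by
  refine Real.le_sqrt_of_sq_le ?_
  have := sq_integral_le (f := fun ω => |f ω|) hf.abs
  simpa only [sq_abs] using this

/-- As `f` is centred, the variance is `E f² + 2 E fg + E g² - (E g)²`. The lemma is used with `f`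
the leading term and `g` the small remainder. -/
lemma abs_variance_const_add_sub_le [IsProbabilityMeasure μ] (hf : MemLp f 2 μ)
    (hg : MemLp g 2 μ) (hf0 : ∫ ω, f ω ∂μ = 0) (c : ℝ) (hT : ∀ ω, h ω = c + (f ω + g ω)) :
    |variance h μ - ∫ ω, f ω ^ 2 ∂μ|
      ≤ 2 * √((∫ ω, f ω ^ 2 ∂μ) * ∫ ω, g ω ^ 2 ∂μ) + ∫ ω, g ω ^ 2 ∂μ := by
  have hfg : MemLp (fun ω => f ω + g ω) 2 μ := hf.add hg
  have h1 : variance h μ = variance (fun ω => f ω + g ω) μ := by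
    rw [← variance_const_add hfg.1 c]
    exact congrArg (variance · μ) (funext hT)
  have hi : Integrable (fun ω => f ω * g ω) μ := hf.integrable_mul hg
  have e : ∀ ω, (f ω + g ω) ^ 2 = f ω ^ 2 + 2 * (f ω * g ω) + g ω ^ 2 := fun ω => by ring
  have h2 : ∫ ω, (f ω + g ω) ^ 2 ∂μ
      = (∫ ω, f ω ^ 2 ∂μ) + 2 * (∫ ω, f ω * g ω ∂μ) + ∫ ω, g ω ^ 2 ∂μ := by
    simp_rw [e]
    rw [integral_add (hf.integrable_sq.fun_add (hi.const_mul _)) hg.integrable_sq,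
      integral_add hf.integrable_sq (hi.const_mul _), integral_const_mul]
  have h3 : ∫ ω, f ω + g ω ∂μ = ∫ ω, g ω ∂μ := by
    rw [integral_add (hf.integrable (by norm_num)) (hg.integrable (by norm_num)), hf0, zero_add]
  rw [h1, variance_eq_sub hfg]
  simp only [Pi.pow_apply]
  rw [h2, h3]
  have h4 := abs_le.1 (abs_integral_mul_le_sqrt hf hg)
  have h5 := sq_integral_le hg
  have h6 := sq_nonneg (∫ ω, g ω ∂μ)
  rw [abs_le]
  constructor <;> linarith [h4.1, h4.2]

end Inequalities

/-! ### The degenerate part of the zero-estimators -/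

section Remainder

variable {n p : ℕ} {Ω : Type*} [MeasurableSpace Ω] {μ : Measure Ω} [IsProbabilityMeasure μ]
  {β : Fin p → ℝ} {s : ℝ} {X : Fin n → Ω → Fin p → ℝ} {Y : Fin n → Ω → ℝ} {S : Finset (Fin p)}

lemma memLp_tripleSum {E : Type*} [MeasurableSpace E] {V : Fin n → Ω → E} {f g k : E → ℝ}
    (hind : iIndepFun V μ) (hV : ∀ i, Measurable (V i)) (hf : Measurable f) (hg : Measurable g)
    (hk : Measurable k) (hfL : ∀ i, MemLp (fun ω => f (V i ω)) 2 μ)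
    (hgL : ∀ i, MemLp (fun ω => g (V i ω)) 2 μ) (hkL : ∀ i, MemLp (fun ω => k (V i ω)) 2 μ) :
    MemLp (fun ω => tripleSum (fun i => f (V i ω)) (fun i => g (V i ω))
      (fun i => k (V i ω))) 2 μ := by
  simp_rw [tripleSum_eq_sum_filter]
  refine memLp_finsetSum _ fun q hq => ?_
  obtain ⟨h1, h2, h3⟩ := (Finset.mem_filter.1 hq).2
  have := memLp_kernelProd (F := ![f, g, k]) (e := ![q.1, q.2.1, q.2.2]) hind hV
    (by simp [Fin.forall_fin_succ, hf, hg, hk])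
    (by
      intro i j hij
      fin_cases i <;> fin_cases j <;> simp_all [eq_comm])
    (by simp [Fin.forall_fin_succ, hfL, hgL, hkL])
  refine (memLp_congr_ae (.of_forall fun ω => ?_)).1 this
  simp [kernelProd, Fin.prod_univ_three]

variable (h : IsLinearModel μ β s X Y) (hg : ∀ i, μ.map (X i) = stdNormal p)
include h hg

lemma integral_coordScore_sq_le (hs : 0 ≤ s) {M : ℝ} (hM : tauSq β + s ≤ M) (j : Fin p)
    (i : Fin n) : ∫ ω, coordScore β j (X i ω, Y i ω) ^ 2 ∂μ ≤ 2 * M := by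
  simp_rw [sq (coordScore β j _)]
  rw [integral_coordScore_mul h hg, scoreCov, if_pos rfl, ← tauSq_eq_dotProduct]
  have := sq_le_tauSq β j
  nlinarith

lemma integral_coordQuad_sq_le (j j' : Fin p) (i : Fin n) :
    ∫ ω, coordQuad j j' (X i ω, Y i ω) ^ 2 ∂μ ≤ 2 := by
  refine (integral_quadScore_sq h hg _ _ i).trans_le ?_
  simp only [single_one_dotProduct, Pi.single_apply]
  split_ifs <;> norm_num

lemma memLp_psiRem (j j' : Fin p) :
    MemLp (fun ω => psiRem β (fun i => X i ω) (fun i => Y i ω) j j') 2 μ := by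
  have z : ∀ j, Measurable (coordScore β j) := fun j => measurable_linScore _ _
  have q : Measurable (coordQuad j j') := measurable_quadScore _ _
  have zL : ∀ j i, MemLp (fun ω => coordScore β j (X i ω, Y i ω)) 2 μ :=
    fun j => memLp_linScore h hg _
  have qL : ∀ i, MemLp (fun ω => coordQuad j j' (X i ω, Y i ω)) 2 μ := memLp_quadScore h hg _ _
  have hV := measurable_obs h
  exact ((((memLp_pairSum h.indep hV (z j') q (zL j') qL).const_mul _).add
    ((memLp_pairSum h.indep hV (z j) q (zL j) qL).const_mul _)).add
    ((memLp_tripleSum h.indep hV (z j) (z j') q (zL j) (zL j') qL).const_mul _))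

/-- The remainder consists of two degenerate pair sums and one degenerate triple sum. Their second
moments are `O(n²)` and `O(n³)`, and the normalizations bring every contribution to `O(n⁻²)` or
smaller. The constant is `744 = 48 + 48 + 648`, with `48 = 3·4·4` and `648 = 3·27·8`, the 3 coming
from the square of a sum of three terms. -/
lemma integral_psiRem_sq_le (hn : 3 ≤ n) {M : ℝ} (hM : tauSq β + s ≤ M) (j j' : Fin p) :
    ∫ ω, psiRem β (fun i => X i ω) (fun i => Y i ω) j j' ^ 2 ∂μ
      ≤ 744 * M ^ 2 / ((n : ℝ) - 2) ^ 2 := by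
  have hn3 : (3 : ℝ) ≤ n := by exact_mod_cast hn
  have hs : 0 ≤ s := sigmaSq_nonneg h (by omega)
  have hM0 : 0 ≤ M := by linarith [tauSq_nonneg β]
  have z : ∀ j, Measurable (coordScore β j) := fun j => measurable_linScore _ _
  have q : Measurable (coordQuad j j') := measurable_quadScore _ _
  have zL : ∀ j i, MemLp (fun ω => coordScore β j (X i ω, Y i ω)) 2 μ :=
    fun j => memLp_linScore h hg _
  have qL : ∀ i, MemLp (fun ω => coordQuad j j' (X i ω, Y i ω)) 2 μ := memLp_quadScore h hg _ _
  have z0 : ∀ j i, ∫ ω, coordScore β j (X i ω, Y i ω) ∂μ = 0 := fun j => integral_linScore h hg _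
  have q0 : ∀ i, ∫ ω, coordQuad j j' (X i ω, Y i ω) ∂μ = 0 := integral_quadScore h hg _ _
  have zK := integral_coordScore_sq_le h hg hs hM
  have qK := integral_coordQuad_sq_le h hg j j'
  have hV := measurable_obs h
  have m1 := memLp_pairSum h.indep hV (z j') q (zL j') qL
  have m2 := memLp_pairSum h.indep hV (z j) q (zL j) qL
  have m3 := memLp_tripleSum h.indep hV (z j) (z j') q (zL j) (zL j') qL
  have b1 := integral_pairSum_sq_le h.indep hV (z j') q (zL j') qL (z0 j') q0 (zK j') qK
    (by positivity) (by norm_num)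
  have b2 := integral_pairSum_sq_le h.indep hV (z j) q (zL j) qL (z0 j) q0 (zK j) qK
    (by positivity) (by norm_num)
  have b3 := integral_tripleSum_sq_le h.indep hV (z j) (z j') q (zL j) (zL j') qL (z0 j) (z0 j') q0
    (zK j) (zK j') qK (by positivity) (by positivity) (by norm_num)
  have c1 := sq_le_tauSq β j
  have c2 := sq_le_tauSq β j'
  set a : ℝ := 1 / ((n : ℝ) * ((n : ℝ) - 1)) with ha
  set c : ℝ := 1 / ((n : ℝ) * ((n : ℝ) - 1) * ((n : ℝ) - 2)) with hc
  have i1 := m1.integrable_sq.const_mul (3 * (a * β j) ^ 2)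
  have i2 := m2.integrable_sq.const_mul (3 * (a * β j') ^ 2)
  have i3 := m3.integrable_sq.const_mul (3 * c ^ 2)
  have step := integral_mono (memLp_psiRem h hg j j').integrable_sq ((i1.fun_add i2).fun_add i3)
    (fun ω => by
      simp only [psiRem, ← ha, ← hc]
      generalize pairSum _ _ = u
      generalize pairSum _ _ = v
      generalize tripleSum _ _ _ = w
      nlinarith [sq_nonneg (a * β j * u - a * β j' * v), sq_nonneg (a * β j * u - c * w),
        sq_nonneg (a * β j' * v - c * w)])
  rw [integral_add (i1.fun_add i2) i3, integral_add i1 i2, integral_const_mul, integral_const_mul,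
    integral_const_mul] at step
  refine step.trans ?_
  have hn2 : 0 < (n : ℝ) - 2 := by linarith
  have ha2 : a ^ 2 * (n : ℝ) ^ 2 ≤ 1 / ((n : ℝ) - 2) ^ 2 := by
    have : a ^ 2 * (n : ℝ) ^ 2 = 1 / ((n : ℝ) - 1) ^ 2 := by
      rw [ha]
      have : (n : ℝ) - 1 ≠ 0 := by linarith
      field_simp
    rw [this]
    exact one_div_le_one_div_of_le (by positivity) (by nlinarith)
  have hc2 : c ^ 2 * (n : ℝ) ^ 3 ≤ 1 / ((n : ℝ) - 2) ^ 2 := by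
    have h1 : (n : ℝ) - 1 ≠ 0 := by linarith
    have : c ^ 2 * (n : ℝ) ^ 3 = (n / ((n : ℝ) - 1) ^ 2) * (1 / ((n : ℝ) - 2) ^ 2) := by
      rw [hc]
      field_simp
    rw [this]
    refine mul_le_of_le_one_left (by positivity) ?_
    rw [div_le_one (by positivity)]
    -- The inequality needed is `n ≤ (n - 1)²`, which holds from `n = 3` on.
    nlinarith
  have hbM : ∀ t : ℝ, t ^ 2 ≤ tauSq β → t ^ 2 ≤ M := fun t ht => by linarith
  have key1 : ∀ (t I : ℝ), t ^ 2 ≤ tauSq β → I ≤ (n : ℝ) ^ 2 * (4 * (2 * M * 2)) →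
      3 * (a * t) ^ 2 * I ≤ 48 * M ^ 2 * (1 / ((n : ℝ) - 2) ^ 2) := by
    intro t I ht hI
    calc 3 * (a * t) ^ 2 * I ≤ 3 * (a * t) ^ 2 * ((n : ℝ) ^ 2 * (4 * (2 * M * 2))) := by gcongr
      _ = 48 * M * (t ^ 2 * (a ^ 2 * (n : ℝ) ^ 2)) := by ring
      _ ≤ 48 * M * (M * (1 / ((n : ℝ) - 2) ^ 2)) := by
        have := hbM t ht
        gcongr
      _ = _ := by ring
  have key3 : 3 * c ^ 2 * ∫ ω, tripleSum (fun i => coordScore β j (X i ω, Y i ω))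
      (fun i => coordScore β j' (X i ω, Y i ω)) (fun i => coordQuad j j' (X i ω, Y i ω)) ^ 2 ∂μ
      ≤ 648 * M ^ 2 * (1 / ((n : ℝ) - 2) ^ 2) := by
    calc _ ≤ 3 * c ^ 2 * ((n : ℝ) ^ 3 * (27 * (2 * M * (2 * M) * 2))) := by gcongr
      _ = 648 * M ^ 2 * (c ^ 2 * (n : ℝ) ^ 3) := by ring
      _ ≤ _ := by gcongr
  have k1 := key1 _ _ c1 b1
  have k2 := key1 _ _ c2 b2
  calc _ ≤ 48 * M ^ 2 * (1 / ((n : ℝ) - 2) ^ 2) + 48 * M ^ 2 * (1 / ((n : ℝ) - 2) ^ 2)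
        + 648 * M ^ 2 * (1 / ((n : ℝ) - 2) ^ 2) := add_le_add (add_le_add k1 k2) key3
    _ = _ := by ring

lemma memLp_sum_psiRem :
    MemLp (fun ω => ∑ j ∈ S, ∑ j' ∈ S, psiRem β (fun i => X i ω) (fun i => Y i ω) j j') 2 μ :=
  memLp_finsetSum _ fun j _ => memLp_finsetSum _ fun j' _ => memLp_psiRem h hg j j'

/-- Cauchy–Schwarz over the `|S|²` terms, without using any cancellation between them; the resulting
`|S|⁴` is harmless because the lemma serves a set of fixed size. -/
lemma integral_sum_psiRem_sq_le (hn : 3 ≤ n) {M : ℝ} (hM : tauSq β + s ≤ M) :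
    ∫ ω, (∑ j ∈ S, ∑ j' ∈ S, psiRem β (fun i => X i ω) (fun i => Y i ω) j j') ^ 2 ∂μ
      ≤ (S.card : ℝ) ^ 4 * (744 * M ^ 2 / ((n : ℝ) - 2) ^ 2) := by
  have hi : ∀ q ∈ S ×ˢ S, Integrable
      (fun ω => psiRem β (fun i => X i ω) (fun i => Y i ω) q.1 q.2 ^ 2) μ :=
    fun q _ => (memLp_psiRem h hg q.1 q.2).integrable_sq
  calc _ ≤ ∫ ω, ((S ×ˢ S).card : ℝ) *
        ∑ q ∈ S ×ˢ S, psiRem β (fun i => X i ω) (fun i => Y i ω) q.1 q.2 ^ 2 ∂μ := by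
        refine integral_mono (memLp_sum_psiRem h hg).integrable_sq
          ((integrable_finsetSum _ hi).const_mul _) fun ω => ?_
        simp only [← Finset.sum_product']
        exact sq_sum_le_card_mul_sum_sq
    _ ≤ ((S ×ˢ S).card : ℝ) * ((S ×ˢ S).card * (744 * M ^ 2 / ((n : ℝ) - 2) ^ 2)) := by
        rw [integral_const_mul, integral_finsetSum _ hi, ← nsmul_eq_mul (S ×ˢ S).card (744 * _ / _)]
        gcongr
        exact Finset.sum_le_card_nsmul _ _ _ fun q _ => integral_psiRem_sq_le h hg hn hM q.1 q.2
    _ = _ := by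
        rw [Finset.card_product]
        push_cast
        ring

lemma memLp_TOn (hn : 3 ≤ n) :
    MemLp (fun ω => TOn (stdNormal p) (fun i => X i ω) (fun i => Y i ω) S) 2 μ := by
  have h1 := (moments_leadingTerm (S := S) h hg (by omega)).1
  have h2 := ((memLp_const (tauSq β)).add h1).sub ((memLp_sum_psiRem (S := S) h hg).const_mul 2)
  refine (memLp_congr_ae (.of_forall fun ω => ?_)).1 h2
  rw [TOn_eq (β := β) hn]
  rfl

/-- The leading term of `Var(T_S)`. -/
noncomputable def leadingVar (n : ℕ) (β : Fin p → ℝ) (s : ℝ)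
    (S : Finset (Fin p)) : ℝ :=
  4 / n * (tauSq β * (tauSq β + s) + tauSq β ^ 2 - 2 * (∑ j ∈ S, β j ^ 2) ^ 2)
    + 2 / (n * ((n : ℝ) - 1)) *
      (p * (tauSq β + s) ^ 2 + 2 * (tauSq β + s) * tauSq β + tauSq β ^ 2)

lemma abs_variance_TOn_sub_le (hn : 3 ≤ n) {M : ℝ} (hM : tauSq β + s ≤ M) :
    |variance (fun ω => TOn (stdNormal p) (fun i => X i ω) (fun i => Y i ω) S) μ
        - leadingVar n β s S|
      ≤ 2 * √(leadingVar n β s S * (4 * ((S.card : ℝ) ^ 4 * (744 * M ^ 2 / ((n : ℝ) - 2) ^ 2))))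
        + 4 * ((S.card : ℝ) ^ 4 * (744 * M ^ 2 / ((n : ℝ) - 2) ^ 2)) := by
  obtain ⟨h1, h2, h3⟩ := moments_leadingTerm (S := S) h hg (by omega)
  have hR := memLp_sum_psiRem (S := S) h hg
  have key := abs_variance_const_add_sub_le (f := linQuadStat (influence β S) (coordScore β)
    Finset.univ (fun i ω => (X i ω, Y i ω)))
    (h := fun ω => TOn (stdNormal p) (fun i => X i ω) (fun i => Y i ω) S) h1
    (hR.const_mul (-2)) h2 (tauSq β) (fun ω => by
      rw [TOn_eq (β := β) hn]
      simp only [linQuadStat]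
      ring)
  have e : ∀ ω, (-2 * ∑ j ∈ S, ∑ j' ∈ S, psiRem β (fun i => X i ω) (fun i => Y i ω) j j') ^ 2
      = 4 * (∑ j ∈ S, ∑ j' ∈ S, psiRem β (fun i => X i ω) (fun i => Y i ω) j j') ^ 2 :=
    fun ω => by ring
  simp_rw [e] at key
  rw [integral_const_mul, h3] at key
  have hb := integral_sum_psiRem_sq_le (S := S) h hg hn hM
  have h0 : 0 ≤ leadingVar n β s S := by
    rw [leadingVar, ← h3]
    exact integral_nonneg fun _ => sq_nonneg _
  refine key.trans ?_
  have h4 : leadingVar n β s S * (4 * ∫ ω, (∑ j ∈ S, ∑ j' ∈ S,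
      psiRem β (fun i => X i ω) (fun i => Y i ω) j j') ^ 2 ∂μ) ≤ leadingVar n β s S *
        (4 * ((S.card : ℝ) ^ 4 * (744 * M ^ 2 / ((n : ℝ) - 2) ^ 2))) := by gcongr
  rw [leadingVar] at h4 ⊢
  gcongr

end Remainder

/-! ### The sample variance of the responses -/

section SampleVariance

variable {n p : ℕ} {Ω : Type*} [MeasurableSpace Ω] {μ : Measure Ω} [IsProbabilityMeasure μ]

lemma integral_abs_average_le {E : Type*} [MeasurableSpace E] {V : Fin n → Ω → E}
    (hind : iIndepFun V μ) {f : E → ℝ} (hf : Measurable f) (hfL : ∀ i, MemLp (fun ω => f (V i ω)) 2 μ)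
    {K : ℝ} (hK : ∀ i, ∫ ω, f (V i ω) ^ 2 ∂μ ≤ K) :
    MemLp (fun ω => 1 / (n : ℝ) * ∑ i, (f (V i ω) - ∫ ω, f (V i ω) ∂μ)) 2 μ ∧
    ∫ ω, (1 / (n : ℝ) * ∑ i, (f (V i ω) - ∫ ω, f (V i ω) ∂μ)) ^ 2 ∂μ ≤ K / n := by
  have hsum : MemLp (fun ω => ∑ i, f (V i ω)) 2 μ := memLp_finsetSum _ fun i _ => hfL i
  have hL : MemLp (fun ω => 1 / (n : ℝ) * ∑ i, (f (V i ω) - ∫ ω, f (V i ω) ∂μ)) 2 μ :=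
    (memLp_finsetSum _ fun i _ => (hfL i).sub (memLp_const _)).const_mul _
  refine ⟨hL, ?_⟩
  have hv : variance (∑ i, fun ω => f (V i ω)) μ = ∑ i, variance (fun ω => f (V i ω)) μ :=
    IndepFun.variance_sum (fun i _ => hfL i) fun i _ k _ hik =>
      (hind.indepFun hik).comp hf hf
  have hv2 : variance (∑ i, fun ω => f (V i ω)) μ
      = ∫ ω, (∑ i, (f (V i ω) - ∫ ω, f (V i ω) ∂μ)) ^ 2 ∂μ := by
    have e : (∑ i, fun ω => f (V i ω)) = fun ω => ∑ i, f (V i ω) := by ext ω; simp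
    rw [e, variance_eq_integral hsum.1.aemeasurable,
      integral_finsetSum _ fun i _ => (hfL i).integrable (by norm_num)]
    simp only [Finset.sum_sub_distrib]
  have hb : ∀ i, variance (fun ω => f (V i ω)) μ ≤ K := fun i =>
    (variance_le_expectation_sq (hfL i).1).trans (hK i)
  have hs : ∑ i, variance (fun ω => f (V i ω)) μ ≤ n * K := by
    refine (Finset.sum_le_card_nsmul _ _ K fun i _ => hb i).trans_eq ?_
    simp
  simp_rw [mul_pow]
  rw [integral_const_mul, ← hv2, hv]
  rcases Nat.eq_zero_or_pos n with rfl | hn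
  · simp
  · have hn0 : (0 : ℝ) < n := by exact_mod_cast hn
    calc _ ≤ (1 / (n : ℝ)) ^ 2 * (n * K) := by gcongr
      _ = _ := by field_simp

variable {β : Fin p → ℝ} {s : ℝ} {X : Fin n → Ω → Fin p → ℝ} {Y : Fin n → Ω → ℝ}

lemma sigmaYSqHat_eq (hn : 2 ≤ n) (y : Fin n → ℝ) :
    sigmaYSqHat y = n / ((n : ℝ) - 1) *
      (1 / (n : ℝ) * ∑ i, y i ^ 2 - (1 / (n : ℝ) * ∑ i, y i) ^ 2) := by
  have hn0 : (n : ℝ) ≠ 0 := by positivity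
  have hn1 : (n : ℝ) - 1 ≠ 0 := by
    have : (2 : ℝ) ≤ n := by exact_mod_cast hn
    linarith
  simp only [sigmaYSqHat, sub_sq, Finset.sum_add_distrib, Finset.sum_sub_distrib,
    ← Finset.sum_mul, ← Finset.mul_sum, Finset.sum_const, Finset.card_univ, Fintype.card_fin,
    nsmul_eq_mul]
  field_simp
  ring

variable (h : IsLinearModel μ β s X Y) (hg : ∀ i, μ.map (X i) = stdNormal p)
include h hg

lemma moments_response (i : Fin n) :
    MemLp (Y i) 2 μ ∧ ∫ ω, Y i ω ∂μ = 0 ∧ ∫ ω, Y i ω ^ 2 ∂μ = tauSq β + s := by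
  have hm := measurable_dotProduct_left β
  have hL := memLp_dotProduct_two β
  obtain ⟨h1, h2, h3⟩ := moments_add_mul_noise h hg i (g := fun _ => 1) (g' := fun _ => 1)
    hm measurable_const hm measurable_const hL (memLp_const 1) hL (memLp_const 1)
  have e : ∀ ω, β ⬝ᵥ X i ω + 1 * noise β X Y i ω = Y i ω := fun ω => by
    rw [one_mul, ← response_eq]
  simp only [e] at h1 h2 h3
  refine ⟨h1, ?_, ?_⟩
  · have hmean : ∫ x, β ⬝ᵥ x ∂stdNormal p = 0 := by
      simp only [dotProduct]
      have hm1 : ∀ j : Fin p, (stdNormal p).map (fun x : Fin p → ℝ => x j) = gaussianReal 0 1 :=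
        fun j => (measurePreserving_eval (fun _ : Fin p => gaussianReal 0 1) j).map_eq
      have hi : ∀ j : Fin p, Integrable (fun x : Fin p → ℝ => x j) (stdNormal p) := fun j => by
        have := memLp_dotProduct_two (Pi.single j 1 : Fin p → ℝ)
        simp only [single_one_dotProduct] at this
        exact this.integrable (by norm_num)
      rw [integral_finsetSum _ fun j _ => (hi j).const_mul _]
      refine Finset.sum_eq_zero fun j _ => ?_
      rw [integral_const_mul, ← integral_map (φ := fun x : Fin p → ℝ => x j) (f := fun y => y)
        (measurable_pi_apply j).aemeasurable measurable_id.aestronglyMeasurable, hm1,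
        integral_id_gaussianReal, mul_zero]
    rw [h2, hmean]
  · simp_rw [sq (Y i _)]
    rw [h3, integral_dotProduct_mul, tauSq_eq_dotProduct]
    simp

/-- `Y² - σ_Y²` splits as `q + (ε² - σ²)`. In `q` the error enters only linearly, so `q` has a
second moment and its average is small in `L²`. The square `ε²` need not have one: its part below
`K` is bounded and again averages out in `L²`, while its part above `K` is at most `δ` in `L¹`.
Hence the result is an `L¹` bound. -/
lemma integral_abs_sigmaYSqHat_sub_le (hn : 2 ≤ n) {M δ : ℝ} {K : ℝ≥0} (hM : tauSq β + s ≤ M)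
    (hδ : 0 ≤ δ)
    (hK : ∀ i, eLpNorm ({ω | K ≤ ‖noise β X Y i ω ^ 2‖₊}.indicator
      fun ω => noise β X Y i ω ^ 2) 1 μ ≤ ENNReal.ofReal δ) :
    Integrable (fun ω => sigmaYSqHat (fun i => Y i ω) - (tauSq β + s)) μ ∧
    ∫ ω, |sigmaYSqHat (fun i => Y i ω) - (tauSq β + s)| ∂μ
      ≤ 2 * (√(20 * M ^ 2 / n) + √((K : ℝ) ^ 2 / n) + 2 * δ + M / n) + M / ((n : ℝ) - 1) := by
  have hn2 : (2 : ℝ) ≤ n := by exact_mod_cast hn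
  have hn0 : (n : ℝ) ≠ 0 := by linarith
  have hs : 0 ≤ s := sigmaSq_nonneg h (by omega)
  have hτ := tauSq_nonneg β
  have hM0 : 0 ≤ M := by linarith
  -- the error as a function of an observation, and its truncations
  set e : (Fin p → ℝ) × ℝ → ℝ := fun d => d.2 - β ⬝ᵥ d.1 with he
  have hem : Measurable e :=
    measurable_snd.sub ((measurable_dotProduct_left β).comp measurable_fst)
  have hen : ∀ i ω, e (X i ω, Y i ω) = noise β X Y i ω := fun i ω => by
    simp [he, noise, dotProduct]
  set A : Set ((Fin p → ℝ) × ℝ) := {d | K ≤ ‖e d ^ 2‖₊} with hA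
  have hAm : MeasurableSet A := measurableSet_le measurable_const (hem.pow_const 2).nnnorm
  set r : (Fin p → ℝ) × ℝ → ℝ := A.indicator fun d => e d ^ 2 with hr
  set t : (Fin p → ℝ) × ℝ → ℝ := Aᶜ.indicator fun d => e d ^ 2 with ht
  have hrm : Measurable r := (hem.pow_const 2).indicator hAm
  have htm : Measurable t := (hem.pow_const 2).indicator hAm.compl
  have hrt : ∀ d, t d + r d = e d ^ 2 := fun d => by
    rw [add_comm]; exact congrFun (Set.indicator_self_add_compl A fun d => e d ^ 2) d
  have hr0 : ∀ d, 0 ≤ r d := Set.indicator_nonneg fun d _ => sq_nonneg (e d)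
  have htK : ∀ d, |t d| ≤ K := by
    intro d
    by_cases hd : d ∈ A
    · simp [ht, hd]
    · have : ‖e d ^ 2‖₊ < K := not_le.1 hd
      have h2 : |e d ^ 2| < K := by exact_mod_cast this
      simpa [ht, hd] using h2.le
  have hV := measurable_obs h
  -- the linear part
  set q : (Fin p → ℝ) × ℝ → ℝ := fun d => 2 * linScore β β d - quadScore β β d with hq
  have hqm : Measurable q :=
    ((measurable_linScore β β).const_mul 2).sub (measurable_quadScore β β)
  have hqL : ∀ i, MemLp (fun ω => q (X i ω, Y i ω)) 2 μ := fun i =>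
    ((memLp_linScore h hg β i).const_mul 2).sub (memLp_quadScore h hg β β i)
  have hq0 : ∀ i, ∫ ω, q (X i ω, Y i ω) ∂μ = 0 := fun i => by
    simp only [hq]
    rw [integral_sub (((memLp_linScore h hg β i).const_mul 2).integrable (by norm_num))
      ((memLp_quadScore h hg β β i).integrable (by norm_num)), integral_const_mul,
      integral_linScore h hg, integral_quadScore h hg]
    simp
  -- `q² ≤ 8 linScore² + 2 quadScore²`, and both scores have second moment at most `2 M²`, which
  -- gives `16 + 4 = 20`.
  have hqK : ∀ i, ∫ ω, q (X i ω, Y i ω) ^ 2 ∂μ ≤ 20 * M ^ 2 := fun i => by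
    have i1 := (memLp_linScore h hg β i).integrable_sq.const_mul 8
    have i2 := (memLp_quadScore h hg β β i).integrable_sq.const_mul 2
    have := integral_mono (hqL i).integrable_sq (i1.fun_add i2) (fun ω => by
      simp only [hq]
      nlinarith [sq_nonneg (2 * linScore β β (X i ω, Y i ω) + quadScore β β (X i ω, Y i ω))])
    refine this.trans ?_
    rw [integral_add i1 i2, integral_const_mul, integral_const_mul, integral_quadScore_sq h hg]
    simp_rw [sq (linScore _ _ _)]
    rw [integral_linScore_mul_linScore h hg, ← tauSq_eq_dotProduct]
    nlinarith [mul_nonneg hτ hs]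
  have htL : ∀ i, MemLp (fun ω => t (X i ω, Y i ω)) 2 μ := fun i =>
    MemLp.of_bound (htm.comp (hV i)).aestronglyMeasurable K (.of_forall fun ω => htK _)
  have htK2 : ∀ i, ∫ ω, t (X i ω, Y i ω) ^ 2 ∂μ ≤ (K : ℝ) ^ 2 := fun i => by
    refine (integral_mono (htL i).integrable_sq (integrable_const _) fun ω =>
      sq_le_sq' (abs_le.1 (htK _)).1 (abs_le.1 (htK _)).2).trans_eq ?_
    simp
  have hesq : ∀ i, Integrable (fun ω => e (X i ω, Y i ω) ^ 2) μ := fun i => by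
    simp_rw [hen]; exact (h.memLp_noise i).integrable_sq
  have hri : ∀ i, Integrable (fun ω => r (X i ω, Y i ω)) μ := fun i => by
    refine ((hesq i).sub ((htL i).integrable (by norm_num))).congr (.of_forall fun ω => ?_)
    simp only [Pi.sub_apply, ← hrt]
    ring
  have hrδ : ∀ i, ∫ ω, r (X i ω, Y i ω) ∂μ ≤ δ := fun i => by
    have h1 := hK i
    rw [eLpNorm_one_eq_lintegral_enorm] at h1
    have h2 : ENNReal.ofReal (∫ ω, r (X i ω, Y i ω) ∂μ) ≤ ENNReal.ofReal δ := by
      rw [ofReal_integral_eq_lintegral_ofReal (hri i) (.of_forall fun ω => hr0 _)]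
      refine (lintegral_mono fun ω => ?_).trans h1
      rw [← Real.enorm_of_nonneg (hr0 _)]
      refine le_of_eq (congrArg _ ?_)
      simp only [hr, hA, Set.indicator, Set.mem_ofPred_eq, hen]
    exact (ENNReal.ofReal_le_ofReal_iff hδ).1 h2
  have hmean : ∀ i, (∫ ω, t (X i ω, Y i ω) ∂μ) + ∫ ω, r (X i ω, Y i ω) ∂μ = s := fun i => by
    rw [← integral_add ((htL i).integrable (by norm_num)) (hri i)]
    simp_rw [hrt, hen]
    exact integral_noise_sq h i
  obtain ⟨l1, b1⟩ := integral_abs_average_le h.indep hqm hqL hqK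
  obtain ⟨l2, b2⟩ := integral_abs_average_le h.indep htm htL htK2
  obtain ⟨l4, b4⟩ := integral_abs_average_le h.indep measurable_snd
    (fun i => (moments_response h hg i).1) (K := M)
    (fun i => (moments_response h hg i).2.2.trans_le hM)
  simp only [hq0, sub_zero] at l1 b1
  simp only [(moments_response h hg _).2.1, sub_zero] at l4 b4
  set a3 : Ω → ℝ := fun ω => 1 / (n : ℝ) *
    ∑ i, (r (X i ω, Y i ω) - ∫ ω, r (X i ω, Y i ω) ∂μ) with ha3
  have l3 : Integrable a3 μ :=
    (integrable_finsetSum _ fun i _ => (hri i).sub (integrable_const _)).const_mul _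
  have b3 : ∫ ω, |a3 ω| ∂μ ≤ 2 * δ := by
    have hi : ∀ i, Integrable
        (fun ω => r (X i ω, Y i ω) + ∫ ω, r (X i ω, Y i ω) ∂μ) μ := fun i =>
      (hri i).add (integrable_const _)
    calc ∫ ω, |a3 ω| ∂μ ≤ ∫ ω, 1 / (n : ℝ) *
          ∑ i, (r (X i ω, Y i ω) + ∫ ω, r (X i ω, Y i ω) ∂μ) ∂μ := by
          refine integral_mono l3.abs ((integrable_finsetSum _ fun i _ => hi i).const_mul _)
            fun ω => ?_
          simp only [ha3, abs_mul, abs_of_nonneg (show (0 : ℝ) ≤ 1 / n by positivity)]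
          gcongr
          refine (Finset.abs_sum_le_sum_abs _ _).trans (Finset.sum_le_sum fun i _ => ?_)
          have h1 := hr0 (X i ω, Y i ω)
          have h2 : 0 ≤ ∫ ω, r (X i ω, Y i ω) ∂μ := integral_nonneg fun ω => hr0 _
          rw [abs_le]
          constructor <;> linarith
      _ ≤ 1 / (n : ℝ) * (n * (2 * δ)) := by
          rw [integral_const_mul, integral_finsetSum _ fun i _ => hi i]
          gcongr
          refine (Finset.sum_le_card_nsmul _ _ (2 * δ) fun i _ => ?_).trans_eq (by simp)
          rw [integral_add (hri i) (integrable_const _), integral_const]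
          simp only [probReal_univ, one_smul]
          linarith [hrδ i]
      _ = 2 * δ := by field_simp
  -- The last summand is the bias left by the factor `n/(n-1)` acting on `σ_Y²`.
  have hdec : ∀ ω, sigmaYSqHat (fun i => Y i ω) - (tauSq β + s)
      = n / ((n : ℝ) - 1) * (1 / (n : ℝ) * ∑ i, q (X i ω, Y i ω)
          + 1 / (n : ℝ) * ∑ i, (t (X i ω, Y i ω) - ∫ ω, t (X i ω, Y i ω) ∂μ) + a3 ω
          - (1 / (n : ℝ) * ∑ i, Y i ω) ^ 2) + (tauSq β + s) / ((n : ℝ) - 1) := by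
    intro ω
    have hn1 : (n : ℝ) - 1 ≠ 0 := by linarith
    have hsum : 1 / (n : ℝ) * ∑ i, Y i ω ^ 2 = 1 / (n : ℝ) * ∑ i, q (X i ω, Y i ω)
          + 1 / (n : ℝ) * ∑ i, (t (X i ω, Y i ω) - ∫ ω, t (X i ω, Y i ω) ∂μ) + a3 ω
          + (tauSq β + s) := by
      have hc : tauSq β + s = 1 / (n : ℝ) * ∑ i : Fin n, (tauSq β + s) := by
        simp only [Finset.sum_const, Finset.card_univ, Fintype.card_fin, nsmul_eq_mul]
        field_simp
      rw [hc, ha3]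
      simp only [← mul_add, ← Finset.sum_add_distrib]
      congr 1
      refine Finset.sum_congr rfl fun i _ => ?_
      rw [← hmean i]
      have h1 := hrt (X i ω, Y i ω)
      simp only [he] at h1
      simp only [hq, linScore, quadScore, tauSq_eq_dotProduct]
      linear_combination -h1
    rw [sigmaYSqHat_eq hn, hsum]
    field_simp
    ring
  have lq := l1.integrable (by norm_num)
  have lt := l2.integrable (by norm_num)
  have ly := l4.integrable_sq
  refine ⟨?_, ?_⟩
  · simp_rw [hdec]
    exact ((((lq.add lt).add l3).sub ly).const_mul _).add (integrable_const _)
  have hfac : 0 ≤ (n : ℝ) / ((n : ℝ) - 1) ∧ (n : ℝ) / ((n : ℝ) - 1) ≤ 2 := by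
    have : 0 < (n : ℝ) - 1 := by linarith
    refine ⟨by positivity, ?_⟩
    rw [div_le_iff₀ this]
    linarith
  have hlast : (tauSq β + s) / ((n : ℝ) - 1) ≤ M / ((n : ℝ) - 1) := by
    have : 0 < (n : ℝ) - 1 := by linarith
    gcongr
  have hlast0 : 0 ≤ (tauSq β + s) / ((n : ℝ) - 1) := by
    have : 0 < (n : ℝ) - 1 := by linarith
    positivity
  have hint := ((((lq.abs.fun_add lt.abs).fun_add l3.abs).fun_add ly).const_mul 2).fun_add
    (integrable_const (μ := μ) (M / ((n : ℝ) - 1)))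
  calc _ ≤ ∫ ω, 2 * (|1 / (n : ℝ) * ∑ i, q (X i ω, Y i ω)|
          + |1 / (n : ℝ) * ∑ i, (t (X i ω, Y i ω) - ∫ ω, t (X i ω, Y i ω) ∂μ)| + |a3 ω|
          + (1 / (n : ℝ) * ∑ i, Y i ω) ^ 2) + M / ((n : ℝ) - 1) ∂μ := by
        refine integral_mono_of_nonneg (.of_forall fun _ => abs_nonneg _) hint
          (.of_forall fun ω => ?_)
        simp only [hdec]
        generalize 1 / (n : ℝ) * ∑ i, q (X i ω, Y i ω) = u1
        generalize 1 / (n : ℝ) * ∑ i, (t (X i ω, Y i ω) - ∫ ω, t (X i ω, Y i ω) ∂μ) = u2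
        generalize a3 ω = u3
        have hsq := sq_nonneg (1 / (n : ℝ) * ∑ i, Y i ω)
        generalize (1 / (n : ℝ) * ∑ i, Y i ω) ^ 2 = u4 at hsq
        refine (abs_add_le _ _).trans (add_le_add ?_ ((abs_of_nonneg hlast0).trans_le hlast))
        rw [abs_mul, abs_of_nonneg hfac.1]
        refine mul_le_mul hfac.2 ?_ (abs_nonneg _) (by norm_num)
        refine (abs_sub _ _).trans (add_le_add ?_ (abs_of_nonneg hsq).le)
        exact (abs_add_le _ _).trans (add_le_add (abs_add_le _ _) le_rfl)
    _ = 2 * ((∫ ω, |1 / (n : ℝ) * ∑ i, q (X i ω, Y i ω)| ∂μ)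
          + (∫ ω, |1 / (n : ℝ) * ∑ i, (t (X i ω, Y i ω) - ∫ ω, t (X i ω, Y i ω) ∂μ)| ∂μ)
          + (∫ ω, |a3 ω| ∂μ) + ∫ ω, (1 / (n : ℝ) * ∑ i, Y i ω) ^ 2 ∂μ) + M / ((n : ℝ) - 1) := by
        rw [integral_add ((((lq.abs.fun_add lt.abs).fun_add l3.abs).fun_add ly).const_mul 2)
          (integrable_const _), integral_const_mul,
          integral_add ((lq.abs.fun_add lt.abs).fun_add l3.abs) ly,
          integral_add (lq.abs.fun_add lt.abs) l3.abs, integral_add lq.abs lt.abs, integral_const]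
        simp
    _ ≤ _ := by
        gcongr
        · exact (integral_abs_le_sqrt l1).trans (Real.sqrt_le_sqrt b1)
        · exact (integral_abs_le_sqrt l2).trans (Real.sqrt_le_sqrt b2)

end SampleVariance

/-! ### Comparison of the variance estimator with the leading term of the variance -/

/-- After multiplication by `n` both expressions are the same quadratic polynomial, at the estimates
and at the true values; its coefficients are bounded because `p/(n-1) ≤ 2P`. The constant 18
collects `4 + 6 + 8` from the `st`, `t²` and `u²` terms, and `4 P` comes from the `s²` term. -/
lemma abs_scaled_varHat_sub_le {n p s t u s₀ t₀ u₀ M P : ℝ} (hn : 2 ≤ n) (hp0 : 0 ≤ p)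
    (hp : p ≤ P * n) (hs₀ : 0 ≤ s₀) (ht₀ : 0 ≤ t₀) (hu₀ : 0 ≤ u₀) (hs : s₀ ≤ M) (ht : t₀ ≤ M)
    (hu : u₀ ≤ M) (ds : |s - s₀| ≤ 1) (dt : |t - t₀| ≤ 1) (du : |u - u₀| ≤ 1) :
    |n * (4 / n * ((n - 2) / (n - 1) * (s * t + t ^ 2) +
        1 / (2 * (n - 1)) * (p * s ^ 2 + 4 * s * t + 3 * t ^ 2)) - 8 / n * u ^ 2)
      - n * (4 / n * (t₀ * s₀ + t₀ ^ 2 - 2 * u₀ ^ 2) + 2 / (n * (n - 1)) *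
        (p * s₀ ^ 2 + 2 * s₀ * t₀ + t₀ ^ 2))|
      ≤ (2 * M + 2) * (18 + 4 * P) * (|s - s₀| + |t - t₀| + |u - u₀|) := by
  have hn0 : n ≠ 0 := by linarith
  have hn1 : 0 < n - 1 := by linarith
  have hn1' : n - 1 ≠ 0 := hn1.ne'
  have hP : 0 ≤ P := by
    by_contra hneg
    nlinarith
  have hM : 0 ≤ M := hs₀.trans hs
  set κ := 1 / (n - 1) with hκ
  have hκ0 : 0 ≤ κ := by positivity
  have hκ1 : κ ≤ 1 := by rw [hκ, div_le_one hn1]; linarith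
  have hpκ : p * κ ≤ 2 * P := by
    rw [hκ, mul_one_div, div_le_iff₀ hn1]
    nlinarith
  have hpκ0 : 0 ≤ p * κ := mul_nonneg hp0 hκ0
  have e : n * (4 / n * ((n - 2) / (n - 1) * (s * t + t ^ 2) +
        1 / (2 * (n - 1)) * (p * s ^ 2 + 4 * s * t + 3 * t ^ 2)) - 8 / n * u ^ 2)
      - n * (4 / n * (t₀ * s₀ + t₀ ^ 2 - 2 * u₀ ^ 2) + 2 / (n * (n - 1)) *
        (p * s₀ ^ 2 + 2 * s₀ * t₀ + t₀ ^ 2))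
      = (4 + 4 * κ) * (s * t - s₀ * t₀) + (4 + 2 * κ) * (t ^ 2 - t₀ ^ 2)
        - 8 * (u ^ 2 - u₀ ^ 2) + 2 * (p * κ) * (s ^ 2 - s₀ ^ 2) := by
    rw [hκ]
    field_simp
    ring
  have hsq : ∀ a a₀ : ℝ, 0 ≤ a₀ → a₀ ≤ M → |a - a₀| ≤ 1 →
      |a ^ 2 - a₀ ^ 2| ≤ (2 * M + 2) * |a - a₀| := by
    intro a a₀ h0 h1 h2
    have h3 := abs_le.1 h2
    have : a ^ 2 - a₀ ^ 2 = (a + a₀) * (a - a₀) := by ring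
    rw [this, abs_mul]
    refine mul_le_mul_of_nonneg_right (abs_le.2 ⟨?_, ?_⟩) (abs_nonneg _) <;> linarith [h3.1, h3.2]
  have hmul : |s * t - s₀ * t₀| ≤ (M + 1) * (|s - s₀| + |t - t₀|) := by
    have : s * t - s₀ * t₀ = s * (t - t₀) + t₀ * (s - s₀) := by ring
    rw [this]
    refine (abs_add_le _ _).trans ?_
    rw [abs_mul, abs_mul]
    have h3 := abs_le.1 ds
    have h1 : |s| ≤ M + 1 := abs_le.2 ⟨by linarith [h3.1], by linarith [h3.2]⟩
    have h2 : |t₀| ≤ M + 1 := by rw [abs_of_nonneg ht₀]; linarith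
    nlinarith [mul_le_mul_of_nonneg_right h1 (abs_nonneg (t - t₀)),
      mul_le_mul_of_nonneg_right h2 (abs_nonneg (s - s₀))]
  have q1 := hsq t t₀ ht₀ ht dt
  have q2 := hsq u u₀ hu₀ hu du
  have q3 := hsq s s₀ hs₀ hs ds
  have w1 : |(4 + 4 * κ) * (s * t - s₀ * t₀)| ≤ 8 * ((M + 1) * (|s - s₀| + |t - t₀|)) := by
    rw [abs_mul, abs_of_nonneg (by positivity)]
    exact mul_le_mul (by linarith) hmul (abs_nonneg _) (by norm_num)
  have w2 : |(4 + 2 * κ) * (t ^ 2 - t₀ ^ 2)| ≤ 6 * ((2 * M + 2) * |t - t₀|) := by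
    rw [abs_mul, abs_of_nonneg (by positivity)]
    exact mul_le_mul (by linarith) q1 (abs_nonneg _) (by norm_num)
  have w3 : |8 * (u ^ 2 - u₀ ^ 2)| ≤ 8 * ((2 * M + 2) * |u - u₀|) := by
    rw [abs_mul, abs_of_nonneg (by norm_num)]
    linarith
  have w4 : |2 * (p * κ) * (s ^ 2 - s₀ ^ 2)| ≤ 4 * P * ((2 * M + 2) * |s - s₀|) := by
    rw [abs_mul, abs_of_nonneg (by positivity)]
    exact mul_le_mul (by linarith) q3 (abs_nonneg _) (by positivity)
  rw [e]
  refine (abs_add_le _ _).trans ?_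
  have a1 := abs_sub ((4 + 4 * κ) * (s * t - s₀ * t₀) + (4 + 2 * κ) * (t ^ 2 - t₀ ^ 2))
    (8 * (u ^ 2 - u₀ ^ 2))
  have a2 := abs_add_le ((4 + 4 * κ) * (s * t - s₀ * t₀)) ((4 + 2 * κ) * (t ^ 2 - t₀ ^ 2))
  have z1 : 0 ≤ (2 * M + 2) * |s - s₀| := by positivity
  have z2 : 0 ≤ (2 * M + 2) * |t - t₀| := by positivity
  have z3 : 0 ≤ (2 * M + 2) * |u - u₀| := by positivity
  have y2 := mul_nonneg hP z2
  have y3 := mul_nonneg hP z3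
  linarith

/-! ### Variances of random variables that agree with high probability -/

section Modification

variable {Ω : Type*} [MeasurableSpace Ω] {μ : Measure Ω} [IsProbabilityMeasure μ] {f g : Ω → ℝ}

lemma memLp_two_of_integrable_pow_four (hf : AEStronglyMeasurable f μ)
    (h4 : Integrable (fun ω => f ω ^ 4) μ) {C : ℝ} (hC : ∫ ω, f ω ^ 4 ∂μ ≤ C) :
    MemLp f 2 μ ∧ MemLp (fun ω => f ω ^ 2) 2 μ ∧ ∫ ω, f ω ^ 2 ∂μ ≤ 1 + C := by
  -- This pointwise comparison turns a fourth moment bound `C` into the second moment bound `1 + C`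
  -- used below.
  have hle : ∀ ω, f ω ^ 2 ≤ 1 + f ω ^ 4 := fun ω => by
    nlinarith [sq_nonneg (f ω ^ 2 - 1), sq_nonneg (f ω)]
  have hi : Integrable (fun ω => 1 + f ω ^ 4) μ := (integrable_const _).add h4
  have h2 : Integrable (fun ω => f ω ^ 2) μ := by
    refine hi.mono' (hf.pow 2) (.of_forall fun ω => ?_)
    rw [Real.norm_of_nonneg (sq_nonneg _)]
    exact hle ω
  refine ⟨(memLp_two_iff_integrable_sq hf).2 h2, (memLp_two_iff_integrable_sq (hf.pow 2)).2 ?_, ?_⟩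
  · simpa only [Pi.pow_apply, ← pow_mul] using h4
  · refine (integral_mono h2 hi hle).trans ?_
    rw [integral_add (integrable_const _) h4]
    simpa using hC

lemma abs_integral_sub_le_of_eqOn {A : Set Ω} (hA : MeasurableSet A) (hf : MemLp f 2 μ)
    (hg : MemLp g 2 μ) (hfg : ∀ ω ∉ A, f ω = g ω) {K : ℝ}
    (hK : ∫ ω, (f ω - g ω) ^ 2 ∂μ ≤ K) :
    |(∫ ω, f ω ∂μ) - ∫ ω, g ω ∂μ| ≤ √K * √(μ.real A) := by
  rw [← integral_sub (hf.integrable (by norm_num)) (hg.integrable (by norm_num))]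
  have h1 : MemLp (A.indicator fun _ => (1 : ℝ)) 2 μ :=
    memLp_indicator_const _ hA _ (Or.inr (measure_ne_top _ _))
  have e : ∀ ω, f ω - g ω = (f ω - g ω) * A.indicator (fun _ => (1 : ℝ)) ω := by
    intro ω
    by_cases hω : ω ∈ A
    · simp [hω]
    · simp [hω, hfg ω hω]
  have key := abs_integral_mul_le_sqrt (f := fun ω => f ω - g ω) (hf.sub hg) h1
  have e2 : ∀ ω, A.indicator (fun _ => (1 : ℝ)) ω ^ 2 = A.indicator 1 ω := by
    intro ω
    by_cases hω : ω ∈ A <;> simp [hω]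
  simp_rw [← e, e2] at key
  rw [integral_indicator_one hA] at key
  refine key.trans ?_
  have hK0 : 0 ≤ K := (integral_nonneg fun _ => sq_nonneg _).trans hK
  rw [← Real.sqrt_mul hK0]
  gcongr

/-- Both `f - g` and `f² - g²` vanish off `A`, so Cauchy–Schwarz against the indicator of `A` bounds
their means by a constant times `√(μ A)`. Fourth moments are needed to put `f² - g²` in `L²`. -/
lemma abs_variance_sub_le_of_eqOn {A : Set Ω} (hA : MeasurableSet A)
    (hf : AEStronglyMeasurable f μ) (hg : AEStronglyMeasurable g μ)
    (hf4 : Integrable (fun ω => f ω ^ 4) μ) (hg4 : Integrable (fun ω => g ω ^ 4) μ) {C : ℝ}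
    (hfC : ∫ ω, f ω ^ 4 ∂μ ≤ C) (hgC : ∫ ω, g ω ^ 4 ∂μ ≤ C) (hfg : ∀ ω ∉ A, f ω = g ω) :
    |variance f μ - variance g μ|
      ≤ (√(2 * C) + √(4 * (1 + C)) * (2 * (1 + C))) * √(μ.real A) := by
  obtain ⟨f1, f2, f3⟩ := memLp_two_of_integrable_pow_four hf hf4 hfC
  obtain ⟨g1, g2, g3⟩ := memLp_two_of_integrable_pow_four hg hg4 hgC
  have hC0 : 0 ≤ C := (integral_nonneg fun ω => by positivity).trans hfC
  have b1 : |(∫ ω, f ω ^ 2 ∂μ) - ∫ ω, g ω ^ 2 ∂μ| ≤ √(2 * C) * √(μ.real A) := by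
    refine abs_integral_sub_le_of_eqOn hA f2 g2 (fun ω hω => by rw [hfg ω hω]) ?_
    refine (integral_mono (f2.sub g2).integrable_sq (hf4.fun_add hg4) fun ω => ?_).trans ?_
    · simp only [Pi.sub_apply]
      nlinarith [mul_nonneg (sq_nonneg (f ω)) (sq_nonneg (g ω))]
    · rw [integral_add hf4 hg4]
      linarith
  have b2 : |(∫ ω, f ω ∂μ) - ∫ ω, g ω ∂μ| ≤ √(4 * (1 + C)) * √(μ.real A) := by
    refine abs_integral_sub_le_of_eqOn hA f1 g1 hfg ?_
    refine (integral_mono (f1.sub g1).integrable_sq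
      ((f1.integrable_sq.const_mul 2).fun_add (g1.integrable_sq.const_mul 2)) fun ω => ?_).trans ?_
    · simp only [Pi.sub_apply]
      nlinarith [sq_nonneg (f ω + g ω)]
    · rw [integral_add (f1.integrable_sq.const_mul 2) (g1.integrable_sq.const_mul 2),
        integral_const_mul, integral_const_mul]
      linarith
  have m : ∀ {k : Ω → ℝ}, MemLp k 2 μ → ∫ ω, k ω ^ 2 ∂μ ≤ 1 + C → |∫ ω, k ω ∂μ| ≤ 1 + C := by
    intro k hk hkC
    have := (sq_integral_le hk).trans hkC
    refine abs_le_of_sq_le_sq (this.trans ?_) (by linarith)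
    nlinarith
  have b3 : |(∫ ω, f ω ∂μ) + ∫ ω, g ω ∂μ| ≤ 2 * (1 + C) :=
    (abs_add_le _ _).trans (by linarith [m f1 f3, m g1 g3])
  rw [variance_eq_sub f1, variance_eq_sub g1]
  simp only [Pi.pow_apply]
  have e : (∫ ω, f ω ^ 2 ∂μ) - (∫ ω, f ω ∂μ) ^ 2 - ((∫ ω, g ω ^ 2 ∂μ) - (∫ ω, g ω ∂μ) ^ 2)
      = ((∫ ω, f ω ^ 2 ∂μ) - ∫ ω, g ω ^ 2 ∂μ)
        - ((∫ ω, f ω ∂μ) - ∫ ω, g ω ∂μ) * ((∫ ω, f ω ∂μ) + ∫ ω, g ω ∂μ) := by ring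
  rw [e]
  refine (abs_sub _ _).trans ?_
  rw [abs_mul]
  have b4 := mul_le_mul b2 b3 (abs_nonneg _) (by positivity)
  linarith

end Modification

/-! ### Bounds that hold for large samples -/

section LargeSample

variable {n p : ℕ} {Ω : Type*} [MeasurableSpace Ω] {μ : Measure Ω} [IsProbabilityMeasure μ]
  {β : Fin p → ℝ} {s : ℝ} {X : Fin n → Ω → Fin p → ℝ} {Y : Fin n → Ω → ℝ} {S : Finset (Fin p)}
  {M P : ℝ}

lemma two_div_mul_le (hn : 2 ≤ n) {d : ℝ} (hdn : d ≤ P * M ^ 2 * n + 3 * M ^ 2)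
    (hP : 0 ≤ P) :
    2 / (n * ((n : ℝ) - 1)) * d ≤ (4 * (P * M ^ 2) + 6 * M ^ 2) / n := by
  have hn2 : (2 : ℝ) ≤ n := by exact_mod_cast hn
  have hn1 : 0 < (n : ℝ) - 1 := by linarith
  have h1 : d ≤ (2 * (P * M ^ 2) + 3 * M ^ 2) * ((n : ℝ) - 1) := by
    nlinarith [mul_nonneg hP (sq_nonneg M), sq_nonneg M]
  calc 2 / (n * ((n : ℝ) - 1)) * d
      ≤ 2 / (n * ((n : ℝ) - 1)) * ((2 * (P * M ^ 2) + 3 * M ^ 2) * ((n : ℝ) - 1)) := by gcongr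
    _ = _ := by field_simp; ring

lemma sum_scoreCov_sq_le (hs : 0 ≤ s) (hM : tauSq β + s ≤ M) (hp : (p : ℝ) ≤ P * n) :
    p * (tauSq β + s) ^ 2 + 2 * (tauSq β + s) * tauSq β + tauSq β ^ 2
      ≤ P * M ^ 2 * n + 3 * M ^ 2 := by
  have hτ := tauSq_nonneg β
  have h1 : (tauSq β + s) ^ 2 ≤ M ^ 2 := by gcongr
  have h2 : (p : ℝ) * (tauSq β + s) ^ 2 ≤ P * n * M ^ 2 :=
    mul_le_mul hp h1 (sq_nonneg _) ((Nat.cast_nonneg _).trans hp)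
  have h3 : (tauSq β + s) * tauSq β ≤ M * M :=
    mul_le_mul hM (by linarith) hτ (by linarith)
  have h4 : tauSq β ^ 2 ≤ M ^ 2 := by
    have : tauSq β ≤ M := by linarith
    gcongr
  nlinarith

lemma leadingVar_le (hn : 2 ≤ n) (hs : 0 ≤ s) (hM : tauSq β + s ≤ M) (hp : (p : ℝ) ≤ P * n)
    (hP : 0 ≤ P) : leadingVar n β s S ≤ (14 * M ^ 2 + 4 * (P * M ^ 2)) / n := by
  have hτ := tauSq_nonneg β
  have hn0 : (0 : ℝ) < n := by exact_mod_cast (by omega : 0 < n)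
  have h1 := two_div_mul_le (M := M) hn (sum_scoreCov_sq_le (β := β) hs hM hp) hP
  have h2 : tauSq β * (tauSq β + s) + tauSq β ^ 2 - 2 * (∑ j ∈ S, β j ^ 2) ^ 2 ≤ 2 * M ^ 2 := by
    have : tauSq β ≤ M := by linarith
    nlinarith [sq_nonneg (∑ j ∈ S, β j ^ 2)]
  have h3 : 4 / (n : ℝ) * (tauSq β * (tauSq β + s) + tauSq β ^ 2 - 2 * (∑ j ∈ S, β j ^ 2) ^ 2)
      ≤ 4 / (n : ℝ) * (2 * M ^ 2) := by gcongr
  rw [leadingVar]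
  refine (add_le_add h3 h1).trans_eq ?_
  ring

variable (h : IsLinearModel μ β s X Y) (hg : ∀ i, μ.map (X i) = stdNormal p)
include h hg

lemma integral_abs_tauSqHatOn_sub_le (hn : 2 ≤ n) (hM : tauSq β + s ≤ M)
    (hp : (p : ℝ) ≤ P * n) (hP : 0 ≤ P) :
    Integrable (fun ω => tauSqHatOn (fun i => X i ω) (fun i => Y i ω) S - ∑ j ∈ S, β j ^ 2) μ ∧
    ∫ ω, |tauSqHatOn (fun i => X i ω) (fun i => Y i ω) S - ∑ j ∈ S, β j ^ 2| ∂μ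
      ≤ √((14 * M ^ 2 + 4 * (P * M ^ 2)) / n) := by
  obtain ⟨h1, h2⟩ := moments_tauSqHatOn (S := S) h hg hn
  refine ⟨h1.integrable (by norm_num), (integral_abs_le_sqrt h1).trans (Real.sqrt_le_sqrt ?_)⟩
  have hs := sigmaSq_nonneg h (by omega)
  have hτ := tauSq_nonneg β
  have hn0 : (0 : ℝ) < n := by exact_mod_cast (by omega : 0 < n)
  have hsub : ∑ j ∈ S, ∑ j' ∈ S, scoreCov β s j j' ^ 2 ≤ ∑ j, ∑ j', scoreCov β s j j' ^ 2 := by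
    refine (Finset.sum_le_sum fun j _ => Finset.sum_le_sum_of_subset_of_nonneg
      (Finset.subset_univ S) fun _ _ _ => sq_nonneg _).trans ?_
    exact Finset.sum_le_sum_of_subset_of_nonneg (Finset.subset_univ S) fun _ _ _ =>
      Finset.sum_nonneg fun _ _ => sq_nonneg _
  rw [sum_scoreCov_sq] at hsub
  have k1 := two_div_mul_le (M := M) hn (hsub.trans (sum_scoreCov_sq_le hs hM hp)) hP
  have hS := sum_sq_le_tauSq β S
  have hS0 : 0 ≤ ∑ j ∈ S, β j ^ 2 := Finset.sum_nonneg fun _ _ => sq_nonneg _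
  have k2 : (∑ j ∈ S, β j ^ 2) * (tauSq β + s) + (∑ j ∈ S, β j ^ 2) ^ 2 ≤ 2 * M ^ 2 := by
    have : ∑ j ∈ S, β j ^ 2 ≤ M := by linarith
    nlinarith
  have k3 : 4 / (n : ℝ) * ((∑ j ∈ S, β j ^ 2) * (tauSq β + s) + (∑ j ∈ S, β j ^ 2) ^ 2)
      ≤ 4 / (n : ℝ) * (2 * M ^ 2) := by gcongr
  rw [h2]
  refine (add_le_add k3 k1).trans_eq ?_
  ring

/-- The leading variance is `O(1/n)` and the remainder's second moment `O(1/n²)`, so the cross term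
is `O(n^{-3/2})` and survives multiplication by `n`. The constant is `36 = 4·9`, from `n ≤ 3(n - 2)`
for `n ≥ 3`. -/
lemma scaled_abs_variance_TOn_sub_le (hn : 3 ≤ n) (hM : tauSq β + s ≤ M)
    (hp : (p : ℝ) ≤ P * n) (hP : 0 ≤ P) :
    n * |variance (fun ω => TOn (stdNormal p) (fun i => X i ω) (fun i => Y i ω) S) μ
        - leadingVar n β s S|
      ≤ 2 * √((14 * M ^ 2 + 4 * (P * M ^ 2)) * (36 * ((S.card : ℝ) ^ 4 * (744 * M ^ 2))) / n)
        + 36 * ((S.card : ℝ) ^ 4 * (744 * M ^ 2)) / n := by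
  have hn3 : (3 : ℝ) ≤ n := by exact_mod_cast hn
  have hn0 : (0 : ℝ) < n := by linarith
  have hs := sigmaSq_nonneg h (by omega)
  have key := abs_variance_TOn_sub_le (S := S) h hg hn hM
  have hL := leadingVar_le (S := S) (by omega) hs hM hp hP
  set L := 14 * M ^ 2 + 4 * (P * M ^ 2) with hLdef
  have hL0 : 0 ≤ L := by positivity
  have hinv : 4 * ((S.card : ℝ) ^ 4 * (744 * M ^ 2 / ((n : ℝ) - 2) ^ 2))
      ≤ 36 * ((S.card : ℝ) ^ 4 * (744 * M ^ 2)) / (n : ℝ) ^ 2 := by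
    have h1 : 0 < (n : ℝ) - 2 := by linarith
    have h2 : 1 / ((n : ℝ) - 2) ^ 2 ≤ 9 / (n : ℝ) ^ 2 := by
      rw [div_le_div_iff₀ (by positivity) (by positivity)]
      nlinarith
    calc _ = 4 * ((S.card : ℝ) ^ 4 * (744 * M ^ 2)) * (1 / ((n : ℝ) - 2) ^ 2) := by ring
      _ ≤ 4 * ((S.card : ℝ) ^ 4 * (744 * M ^ 2)) * (9 / (n : ℝ) ^ 2) := by gcongr
      _ = _ := by ring
  set B := 36 * ((S.card : ℝ) ^ 4 * (744 * M ^ 2)) with hB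
  have hB0 : 0 ≤ B := by positivity
  have h0 : 0 ≤ 4 * ((S.card : ℝ) ^ 4 * (744 * M ^ 2 / ((n : ℝ) - 2) ^ 2)) := by positivity
  calc _ ≤ n * (2 * √(L / n * (B / (n : ℝ) ^ 2)) + B / (n : ℝ) ^ 2) := by
        gcongr
        refine key.trans (add_le_add ?_ hinv)
        gcongr
    _ = 2 * (√((n : ℝ) ^ 2) * √(L / n * (B / (n : ℝ) ^ 2))) + B / n := by
        rw [Real.sqrt_sq hn0.le]
        field_simp
    _ = _ := by
        rw [← Real.sqrt_mul (by positivity)]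
        congr 3
        field_simp

end LargeSample

/-! ### Convergence in probability and measurability under selection -/

section Convergence

variable {Ω : Type*} [MeasurableSpace Ω] {μ : Measure Ω} [IsProbabilityMeasure μ]

lemma tendsto_measureReal_abs_ge_of_integral {d : ℕ → Ω → ℝ}
    (hi : ∀ᶠ n in atTop, Integrable (d n) μ)
    (hd : Tendsto (fun n => ∫ ω, |d n ω| ∂μ) atTop (𝓝 0)) {η : ℝ} (hη : 0 < η) :
    Tendsto (fun n => μ.real {ω | η ≤ |d n ω|}) atTop (𝓝 0) := by
  have h1 : Tendsto (fun n => (∫ ω, |d n ω| ∂μ) / η) atTop (𝓝 0) := by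
    simpa using hd.div_const η
  refine tendsto_of_tendsto_of_tendsto_of_le_of_le' tendsto_const_nhds h1
    (.of_forall fun n => measureReal_nonneg) ?_
  filter_upwards [hi] with n hn
  rw [le_div_iff₀ hη, mul_comm]
  exact mul_meas_ge_le_integral_of_nonneg (.of_forall fun _ => abs_nonneg _) hn.abs η

lemma tendsto_sqrt_const_div (c : ℝ) : Tendsto (fun n : ℕ => √(c / n)) atTop (𝓝 0) := by
  have := (Real.continuous_sqrt.tendsto 0).comp (tendsto_const_div_atTop_nhds_zero_nat c)
  rw [Real.sqrt_zero] at this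
  exact this

/-- The event that a selection algorithm chooses a given set is measurable. -/
lemma measurableSet_select_eq {n p : ℕ} (γ : SelectionAlgorithm) {X : Fin n → Ω → Fin p → ℝ}
    {Y : Fin n → Ω → ℝ} (hX : ∀ i, Measurable (X i)) (hY : ∀ i, Measurable (Y i))
    (S : Finset (Fin p)) :
    MeasurableSet {ω | γ.select (fun i => X i ω) (fun i => Y i ω) = S} := by
  have hm : Measurable fun ω => ((fun i => X i ω), (fun i => Y i ω)) :=
    (measurable_pi_lambda _ hX).prodMk (measurable_pi_lambda _ hY)
  exact hm (γ.measurableSet_select n p S)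

/-- There are finitely many possible selections, so the selected statistic is a finite sum of fixed
statistics times indicators of selection events. -/
lemma aestronglyMeasurable_of_select {ι : Type*} [Fintype ι] [DecidableEq ι] {B : Ω → ι}
    (hB : ∀ S, MeasurableSet {ω | B ω = S}) {T : ι → Ω → ℝ}
    (hT : ∀ S, AEStronglyMeasurable (T S) μ) :
    AEStronglyMeasurable (fun ω => T (B ω) ω) μ := by
  have e : (fun ω => T (B ω) ω) = fun ω => ∑ S, {ω | B ω = S}.indicator (T S) ω := by
    ext ω
    rw [Finset.sum_eq_single (B ω)]
    · simp
    · intro S _ hS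
      have : ω ∉ {ω | B ω = S} := fun h => hS (Eq.symm h)
      rw [Set.indicator_of_notMem this]
    · simp
  rw [e]
  exact Finset.aestronglyMeasurable_fun_sum _ fun S _ => (hT S).indicator (hB S)

end Convergence

end SignalEst

/-! ### The proposition -/

open SignalEst

theorem mainTheorem12 {Ω : Type*} [MeasurableSpace Ω] (μ : Measure Ω) [IsProbabilityMeasure μ]
    -- for every sample size `n`: the dimension, the parameters and the sample
    (p : ℕ → ℕ) (β : ∀ n, Fin (p n) → ℝ) (sigmaSq : ℕ → ℝ)
    (X : ∀ n, Fin n → Ω → Fin (p n) → ℝ) (Y : ∀ n, Fin n → Ω → ℝ)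
    (hmodel : ∀ n, SignalEst.IsLinearModel μ (β n) (sigmaSq n) (X n) (Y n))
    -- the covariates are standard normal
    (hgauss : ∀ n i, μ.map (X n i) = SignalEst.stdNormal (p n))
    -- `τ² + σ² = O(1)` and `p / n = O(1)`
    (hbdd : (fun n => SignalEst.tauSq (β n) + sigmaSq n) =O[atTop] fun _ => (1 : ℝ))
    (hp : (fun n => (p n : ℝ)) =O[atTop] fun n => (n : ℝ))
    -- the squared errors are uniformly integrable
    (hUI : UniformIntegrable
      (fun (k : Σ n : ℕ, Fin n) ω => SignalEst.noise (β k.1) (X k.1) (Y k.1) k.2 ω ^ 2) 1 μ)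
    -- the set of large coefficients has a fixed number of elements
    (b : ℝ) (hb : 0 < b) (p₀ : ℕ)
    (hcard : ∀ᶠ n in atTop, (SignalEst.largeCoeffs (β n) b).card = p₀)
    -- the selection algorithm
    (γ : SignalEst.SelectionAlgorithm)
    (Bγ : ∀ n, Ω → Finset (Fin (p n)))
    (hBγ : ∀ n ω, Bγ n ω = γ.select (fun i => X n i ω) (fun i => Y n i ω))
    (hsel : Tendsto
      (fun n : ℕ => (n : ℝ) * √(μ.real {ω | Bγ n ω ≠ SignalEst.largeCoeffs (β n) b}))
      atTop (𝓝 0))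
    -- the estimators `T_γ` and `T_B`, with bounded fourth moments
    (Tγ TB : ℕ → Ω → ℝ)
    (hTγ : ∀ n ω, Tγ n ω = SignalEst.TOn (SignalEst.stdNormal (p n))
      (fun i => X n i ω) (fun i => Y n i ω) (Bγ n ω))
    (hTB : ∀ n ω, TB n ω = SignalEst.TOn (SignalEst.stdNormal (p n))
      (fun i => X n i ω) (fun i => Y n i ω) (SignalEst.largeCoeffs (β n) b))
    (hTγ4 : ∃ C : ℝ, ∀ᶠ n in atTop,
      Integrable (fun ω => Tγ n ω ^ 4) μ ∧ ∫ ω, Tγ n ω ^ 4 ∂μ ≤ C)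
    (hTB4 : ∃ C : ℝ, ∀ᶠ n in atTop,
      Integrable (fun ω => TB n ω ^ 4) μ ∧ ∫ ω, TB n ω ^ 4 ∂μ ≤ C) :
    TendstoInMeasure μ
      (fun (n : ℕ) ω => (n : ℝ) *
        (SignalEst.varHatTOn (fun i => X n i ω) (fun i => Y n i ω) (Bγ n ω) -
          variance (Tγ n) μ))
      atTop (fun _ => 0) := by
  classical
  -- uniform bounds on the parameters
  obtain ⟨M, hM0, hM⟩ : ∃ M : ℝ, 0 ≤ M ∧
      ∀ᶠ n in atTop, tauSq (β n) + sigmaSq n ≤ M := by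
    obtain ⟨c, hc⟩ := hbdd.bound
    refine ⟨max c 0, le_max_right _ _, hc.mono fun n hn => ?_⟩
    simp only [norm_one, mul_one] at hn
    exact (le_abs_self _).trans (hn.trans (le_max_left _ _))
  obtain ⟨P, hP0, hP⟩ : ∃ P : ℝ, 0 ≤ P ∧ ∀ᶠ n in atTop, (p n : ℝ) ≤ P * n := by
    obtain ⟨c, hc⟩ := hp.bound
    refine ⟨max c 0, le_max_right _ _, hc.mono fun n hn => ?_⟩
    simp only [RCLike.norm_natCast] at hn
    exact hn.trans (by gcongr; exact le_max_left _ _)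
  obtain ⟨C₁, hC₁⟩ := hTγ4
  obtain ⟨C₂, hC₂⟩ := hTB4
  set B : ∀ n, Finset (Fin (p n)) := fun n => largeCoeffs (β n) b with hB
  -- the exceptional event of the selection
  set A : ℕ → Set Ω := fun n => {ω | Bγ n ω ≠ B n} with hA
  have hBm : ∀ n S, MeasurableSet {ω | Bγ n ω = S} := by
    intro n S
    simp_rw [hBγ]
    exact measurableSet_select_eq γ (hmodel n).measurable_X (hmodel n).measurable_Y S
  have hAm : ∀ n, MeasurableSet (A n) := fun n => (hBm n (B n)).compl
  have hA0 : Tendsto (fun n => μ.real (A n)) atTop (𝓝 0) := by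
    -- The square is `n² P(A n)`, which dominates `P(A n)` once `n ≥ 1`.
    have h2 : Tendsto (fun n : ℕ => ((n : ℝ) * √(μ.real (A n))) ^ 2) atTop (𝓝 0) := by
      simpa using hsel.pow 2
    refine tendsto_of_tendsto_of_tendsto_of_le_of_le' tendsto_const_nhds h2
      (.of_forall fun n => measureReal_nonneg) ?_
    filter_upwards [eventually_ge_atTop 1] with n hn
    have hn1 : (1 : ℝ) ≤ n := by exact_mod_cast hn
    rw [mul_pow, Real.sq_sqrt measureReal_nonneg]
    exact le_mul_of_one_le_left measureReal_nonneg (one_le_pow₀ hn1)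
  -- the sampling variance of `T_γ`
  have hvar : Tendsto (fun n : ℕ => (n : ℝ) *
      |variance (Tγ n) μ - leadingVar n (β n) (sigmaSq n) (B n)|) atTop (𝓝 0) := by
    set D := √(2 * max C₁ C₂) + √(4 * (1 + max C₁ C₂)) * (2 * (1 + max C₁ C₂)) with hD
    set L := (14 * M ^ 2 + 4 * (P * M ^ 2)) * (36 * ((p₀ : ℝ) ^ 4 * (744 * M ^ 2))) with hL
    have hlim : Tendsto (fun n : ℕ => D * ((n : ℝ) * √(μ.real (A n))) + (2 * √(L / n)
        + 36 * ((p₀ : ℝ) ^ 4 * (744 * M ^ 2)) / n)) atTop (𝓝 0) := by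
      have := (hsel.const_mul D).add (((tendsto_sqrt_const_div L).const_mul 2).add
        (tendsto_const_div_atTop_nhds_zero_nat (36 * ((p₀ : ℝ) ^ 4 * (744 * M ^ 2)))))
      simpa using this
    refine tendsto_of_tendsto_of_tendsto_of_le_of_le' tendsto_const_nhds hlim
      (.of_forall fun n => by positivity) ?_
    filter_upwards [hM, hP, hC₁, hC₂, hcard, eventually_ge_atTop 3] with n hMn hPn h1 h2 hcn hn
    have hTm : ∀ S, AEStronglyMeasurable
        (fun ω => TOn (stdNormal (p n)) (fun i => X n i ω) (fun i => Y n i ω) S) μ :=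
      fun S => (memLp_TOn (hmodel n) (hgauss n) hn).1
    have m1 : AEStronglyMeasurable (Tγ n) μ := by
      rw [show Tγ n = _ from funext (hTγ n)]
      exact aestronglyMeasurable_of_select (hBm n) hTm
    have m2 : AEStronglyMeasurable (TB n) μ := by
      rw [show TB n = _ from funext (hTB n)]
      exact hTm _
    have k1 := abs_variance_sub_le_of_eqOn (hAm n) m1 m2 h1.1 h2.1
      (h1.2.trans (le_max_left C₁ C₂)) (h2.2.trans (le_max_right C₁ C₂)) (fun ω hω => by
        rw [hTγ, hTB, show Bγ n ω = B n from not_not.1 hω])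
    have k2 := scaled_abs_variance_TOn_sub_le (S := B n) (hmodel n) (hgauss n) hn hMn hPn hP0
    rw [show (fun ω => TOn (stdNormal (p n)) (fun i => X n i ω) (fun i => Y n i ω) (B n)) = TB n
      from (funext (hTB n)).symm, show (B n).card = p₀ from hcn] at k2
    calc _ ≤ (n : ℝ) * (|variance (Tγ n) μ - variance (TB n) μ|
          + |variance (TB n) μ - leadingVar n (β n) (sigmaSq n) (B n)|) := by
          gcongr
          exact abs_sub_le _ _ _
      _ ≤ n * (D * √(μ.real (A n)))
          + n * |variance (TB n) μ - leadingVar n (β n) (sigmaSq n) (B n)| := by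
          rw [mul_add]
          gcongr
      _ ≤ _ := by
          refine add_le_add (le_of_eq (by ring)) k2
  -- consistency of the plug-in quantities
  have hτ : ∀ S : ∀ n, Finset (Fin (p n)), ∀ η : ℝ, 0 < η → Tendsto (fun n : ℕ => μ.real {ω | η ≤
      |tauSqHatOn (fun i => X n i ω) (fun i => Y n i ω) (S n) - ∑ j ∈ S n, β n j ^ 2|})
      atTop (𝓝 0) := by
    intro S η hη
    have hev := hM.and (hP.and (eventually_ge_atTop 2))
    refine tendsto_measureReal_abs_ge_of_integral (hev.mono fun n hn =>
      (integral_abs_tauSqHatOn_sub_le (S := S n) (hmodel n) (hgauss n) hn.2.2 hn.1 hn.2.1 hP0).1)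
      (tendsto_of_tendsto_of_tendsto_of_le_of_le' tendsto_const_nhds
        (tendsto_sqrt_const_div (14 * M ^ 2 + 4 * (P * M ^ 2)))
        (.of_forall fun n => integral_nonneg fun _ => abs_nonneg _) (hev.mono fun n hn => ?_)) hη
    exact (integral_abs_tauSqHatOn_sub_le (S := S n) (hmodel n) (hgauss n) hn.2.2 hn.1 hn.2.1
      hP0).2
  have hσ : ∀ η : ℝ, 0 < η → Tendsto (fun n : ℕ => μ.real {ω | η ≤
      |sigmaYSqHat (fun i => Y n i ω) - (tauSq (β n) + sigmaSq n)|}) atTop (𝓝 0) := by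
    intro η hη
    -- The order of limits matters: uniform integrability gives, for each `δ`, a truncation level
    -- `K` valid for all `n`, and only then does `n` tend to infinity.
    have hev : ∀ δ : ℝ, 0 < δ → ∃ K : NNReal, ∀ᶠ n : ℕ in atTop,
        Integrable (fun ω => sigmaYSqHat (fun i => Y n i ω) - (tauSq (β n) + sigmaSq n)) μ ∧
        ∫ ω, |sigmaYSqHat (fun i => Y n i ω) - (tauSq (β n) + sigmaSq n)| ∂μ
          ≤ 2 * (√(20 * M ^ 2 / n) + √((K : ℝ) ^ 2 / n) + 2 * δ + M / n) + M / ((n : ℝ) - 1) := by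
      intro δ hδ
      obtain ⟨K, hK⟩ := hUI.spec one_ne_zero ENNReal.one_ne_top hδ
      refine ⟨K, ?_⟩
      filter_upwards [hM, eventually_ge_atTop 2] with n hMn hn
      exact integral_abs_sigmaYSqHat_sub_le (hmodel n) (hgauss n) hn hMn hδ.le
        fun i => hK ⟨n, i⟩
    refine tendsto_measureReal_abs_ge_of_integral ?_ ?_ hη
    · obtain ⟨K, hK⟩ := hev 1 one_pos
      exact hK.mono fun n hn => hn.1
    · rw [Metric.tendsto_atTop']
      intro ε hε
      -- With `δ = ε / 8` the bound tends to `2 · 2δ = ε / 2`, which is below `ε`.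
      obtain ⟨K, hK⟩ := hev (ε / 8) (by positivity)
      have hshift : Tendsto (fun n : ℕ => M / ((n : ℝ) - 1)) atTop (𝓝 0) :=
        tendsto_const_nhds.div_atTop
          (tendsto_atTop_add_const_right _ (-1 : ℝ) tendsto_natCast_atTop_atTop)
      have hlim := (((((tendsto_sqrt_const_div (20 * M ^ 2)).add
        (tendsto_sqrt_const_div ((K : ℝ) ^ 2))).add_const (2 * (ε / 8))).add
        (tendsto_const_div_atTop_nhds_zero_nat M)).const_mul 2).add hshift
      have hlt := hlim.eventually_lt_const (u := ε) (by linarith)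
      obtain ⟨N, hN⟩ := (hK.and hlt).exists_forall_of_atTop
      refine ⟨N, fun n hn => ?_⟩
      obtain ⟨h1, h2⟩ := hN n hn.le
      rw [Real.dist_eq, sub_zero, abs_of_nonneg (integral_nonneg fun _ => abs_nonneg _)]
      exact h1.2.trans_lt h2
  -- conclusion
  rw [tendstoInMeasure_iff_measureReal_norm]
  intro ε hε
  set C := (2 * M + 2) * (18 + 4 * P) with hC
  have hCpos : 0 < C := by positivity
  -- The 1 keeps the estimates in the range of the Lipschitz bound; the other term makes the three
  -- deviations cost at most `3ε/8` together.
  set η := min 1 (ε / (8 * C)) with hη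
  have hηpos : 0 < η := lt_min one_pos (by positivity)
  have hlim := ((hA0.add (hσ η hηpos)).add (hτ (fun n => Finset.univ) η hηpos)).add
    (hτ B η hηpos)
  simp only [add_zero] at hlim
  refine tendsto_of_tendsto_of_tendsto_of_le_of_le' tendsto_const_nhds hlim
    (.of_forall fun n => measureReal_nonneg) ?_
  filter_upwards [hM, hP, eventually_ge_atTop 3,
    hvar.eventually_lt_const (u := ε / 2) (by linarith)] with n hMn hPn hn hvn
  -- A deviation of size `ε` forces a wrong selection or a deviation of at least `η` in one of the
  -- three plug-in estimators. Otherwise the selected set is `B` and the error is below `3ε/8 + ε/2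
  -- < ε`.
  refine (measureReal_mono (fun ω hω => ?_)).trans ((measureReal_union_le _ _).trans
    (add_le_add ((measureReal_union_le _ _).trans (add_le_add (measureReal_union_le _ _) le_rfl))
      le_rfl))
  by_contra hnot
  simp only [Set.mem_union, not_or, Set.mem_ofPred_eq, not_le] at hnot
  obtain ⟨⟨⟨n1, n2⟩, n3⟩, n4⟩ := hnot
  have hBeq : Bγ n ω = B n := not_not.1 n1
  simp only [Set.mem_ofPred_eq, sub_zero, Real.norm_eq_abs] at hω
  have hs0 := sigmaSq_nonneg (hmodel n) (by omega)
  have ht0 := tauSq_nonneg (β n)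
  have hu := sum_sq_le_tauSq (β n) (B n)
  have hη1 : η ≤ 1 := min_le_left _ _
  have hηC : C * η ≤ ε / 8 := by
    calc C * η ≤ C * (ε / (8 * C)) := by gcongr; exact min_le_right _ _
      _ = ε / 8 := by field_simp
  have key := abs_scaled_varHat_sub_le (n := (n : ℝ)) (p := (p n : ℝ))
    (s := sigmaYSqHat fun i => Y n i ω) (t := tauSqHat (fun i => X n i ω) fun i => Y n i ω)
    (u := tauSqHatOn (fun i => X n i ω) (fun i => Y n i ω) (B n))
    (s₀ := tauSq (β n) + sigmaSq n) (t₀ := tauSq (β n)) (u₀ := ∑ j ∈ B n, β n j ^ 2)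
    (M := M) (P := P) (by exact_mod_cast (by omega : 2 ≤ n)) (Nat.cast_nonneg _) hPn
    (by positivity) ht0 (Finset.sum_nonneg fun _ _ => sq_nonneg _) hMn (by linarith)
    (by linarith) (n2.le.trans hη1) (n3.le.trans hη1) (n4.le.trans hη1)
  rw [hBeq, varHatTOn, varHatTauSqHat] at hω
  have hfin := abs_sub_le
    ((n : ℝ) * varHatTOn (fun i => X n i ω) (fun i => Y n i ω) (B n))
    (n * leadingVar n (β n) (sigmaSq n) (B n)) (n * variance (Tγ n) μ)
  have e2 : |(n : ℝ) * leadingVar n (β n) (sigmaSq n) (B n) - n * variance (Tγ n) μ|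
      = n * |variance (Tγ n) μ - leadingVar n (β n) (sigmaSq n) (B n)| := by
    rw [← mul_sub, abs_mul, abs_sub_comm, abs_of_nonneg (Nat.cast_nonneg n)]
  rw [e2, ← mul_sub, varHatTOn, varHatTauSqHat] at hfin
  have hk : C * (|sigmaYSqHat (fun i => Y n i ω) - (tauSq (β n) + sigmaSq n)|
      + |tauSqHat (fun i => X n i ω) (fun i => Y n i ω) - tauSq (β n)|
      + |tauSqHatOn (fun i => X n i ω) (fun i => Y n i ω) (B n) - ∑ j ∈ B n, β n j ^ 2|)
      ≤ C * (η + η + η) := by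
    gcongr
    exact n3.le
  have key2 := key.trans hk
  rw [leadingVar] at hfin hvn
  linarith
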